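/- Let $m\ge 1$ and $N_1,N_2\ge 0$ be integers and let $V=\mathbb F_2^m$ (the additive group of $\mathbb F_{2^m}$). **Codes.** A binary code of length $(N_1,N_2)$ is a linear subspace $C\le\mathbb F_2^{N_1+N_2}$. It is *self-dual* if $C=C^\perp$ with respect to $\beta(x,y)=\sum_{i\le N_1}x_iy_i-\sum_{i>N_1}x_iy_i\in\mathbb F_2$, and *doubly-even* if $4$ divides $\mathrm{wt}(c)=\sum_{i\le N_1}c_i-\sum_{i>N_1}c_i\in\mathbb Z$ for every $c\in C$ (entries read as the integers $0,1$). Two such codes are *equivalent* if one is obtained from the other by permuting the first $N_1$ coordinates among themselves and the last $N_2$ coordinates among themselves. Let $C(m)$ be the set of all $m\times(N_1+N_2)$ binary matrices all of whose rows lie in $C$; equivalently, reading matrices as words $(c_1,\dots,c_{N_1+N_2})$ of columns $c_j\in V$, $C(m)=C\otimes_{\mathbb F_2}\mathbb F_{2^m}$. Its *complete conjugate weight enumerator* is $$\mathrm{ccwe}(C(m))=\sum_{c\in C(m)}x_{c_1}\cdots x_{c_{N_1}}\,\overline{x_{c_{N_1+1}}}\cdots\overline{x_{c_{N_1+N_2}}}\in\mathbb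 C[x_f,\overline{x_f}\mid f\in V].$$ **Group.** The complex Clifford group $\mathcal X_m\le U(2^m)$ acts on $\mathbb C^{2^m}$ with orthonormal basis $(e_v)_{v\in V}$ and is generated by: the diagonal elements $d_S:e_v\mapsto i^{\,v^TSv}e_v$ for all symmetric integral $m\times m$ matrices $S$ (entries of $v$ read as integers $0,1$); the permutation elements $e_v\mapsto e_{gv+v'}$ for all $g\in GL(m,2)$, $v'\in V$; and $h\otimes I_2\otimes\cdots\otimes I_2$ with $h=\frac1{\sqrt2}\begin{pmatrix}1&1\\1&-1\end{pmatrix}$. An element $U=(U_{wv})$ of $\mathcal X_m$ acts on $\mathbb C[x_f,\overline{x_f}]$ by the algebra automorphism $x_v\mapsto\sum_wU_{wv}x_w$, $\overline{x_v}\mapsto\sum_w\overline{U_{wv}}\,\overline{x_w}$. **Theorem.** The space of $\mathcal X_m$-invariant conjugate polynomials in $\mathbb C[x_f,\overline{x_f}\mid f\in V]$ that are homogeneous of degree $N_1$ in the $x_f$ and of degree $N_2$ in the $\overline{x_f}$ is spanned over $\mathbb C$ by the polynomials $\mathrm{ccwe}(C(m))$, where $C$ ranges over all binary doubly-even self-dual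 codes of length $(N_1,N_2)$. If moreover $m+1\ge (N_1+N_2)/2$, these enumerators form a basis of that space, indexed by the equivalence classes of such codes: $\mathrm{ccwe}(C(m))$ depends only on the equivalence class of $C$, and the family with one member for each class is a basis. -/

import Mathlib

open scoped BigOperators

namespace CliffordCodes

/-! ### Binary codes of length `(N₁, N₂)` -/

/-- Positions of a word of length `(N₁, N₂)`: the first `N₁` and the last `N₂` coordinates. -/
abbrev Pos (N₁ N₂ : ℕ) : Type := Fin N₁ ⊕ Fin N₂

/-- A binary linear code of length `(N₁, N₂)`. -/
abbrev BinaryCode (N₁ N₂ : ℕ) : Type := Submodule (ZMod 2) (Pos N₁ N₂ → ZMod 2)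

/-- The form `β(x, y) = x₁y₁ + ⋯ + x_{N₁}y_{N₁} - x_{N₁+1}y_{N₁+1} - ⋯ - x_{N₁+N₂}y_{N₁+N₂}`. -/
def beta {N₁ N₂ : ℕ} (x y : Pos N₁ N₂ → ZMod 2) : ZMod 2 :=
  ∑ i, x (Sum.inl i) * y (Sum.inl i) - ∑ j, x (Sum.inr j) * y (Sum.inr j)

/-- The dual code `C^⊥` with respect to `β`. -/
def dualCode {N₁ N₂ : ℕ} (C : BinaryCode N₁ N₂) : BinaryCode N₁ N₂ where
  carrier := {y | ∀ c ∈ C, beta c y = 0}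
  zero_mem' := by
    intro c _
    simp [beta]
  add_mem' := by
    intro y z hy hz c hc
    have h1 := hy c hc
    have h2 := hz c hc
    simp only [beta, Pi.add_apply, mul_add, Finset.sum_add_distrib] at *
    linear_combination h1 + h2
  smul_mem' := by
    intro a y hy c hc
    have h1 := hy c hc
    simp only [beta, Pi.smul_apply, smul_eq_mul, mul_left_comm _ a, ← Finset.mul_sum] at *
    linear_combination a * h1

/-- The weight `c₁ + ⋯ + c_{N₁} - c_{N₁+1} - ⋯ - c_{N₁+N₂}`, an integer; the entries `0, 1` of `c`
are read as integers. -/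
def wt {N₁ N₂ : ℕ} (c : Pos N₁ N₂ → ZMod 2) : ℤ :=
  ∑ i, ((c (Sum.inl i)).val : ℤ) - ∑ j, ((c (Sum.inr j)).val : ℤ)

/-- All weights are divisible by `4`. -/
def IsDoublyEven {N₁ N₂ : ℕ} (C : BinaryCode N₁ N₂) : Prop := ∀ c ∈ C, (4 : ℤ) ∣ wt c

/-- The code equals its dual. -/
def IsSelfDual {N₁ N₂ : ℕ} (C : BinaryCode N₁ N₂) : Prop := C = dualCode C

/-- The doubly-even self-dual binary codes of length `(N₁, N₂)`. -/
abbrev DoublyEvenSelfDualCode (N₁ N₂ : ℕ) : Type :=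
  {C : BinaryCode N₁ N₂ // IsDoublyEven C ∧ IsSelfDual C}

/-- Two codes of length `(N₁, N₂)` are equivalent if one is obtained from the other by permuting
the first `N₁` coordinates among themselves and the last `N₂` coordinates among themselves. -/
def Equivalent {N₁ N₂ : ℕ} (C D : BinaryCode N₁ N₂) : Prop :=
  ∃ (σ : Equiv.Perm (Fin N₁)) (τ : Equiv.Perm (Fin N₂)),
    ∀ c : Pos N₁ N₂ → ZMod 2, c ∈ D ↔ (fun p => c (Sum.map σ τ p)) ∈ C

/-- Equivalence, as an equivalence relation on doubly-even self-dual codes. -/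
def codeSetoid (N₁ N₂ : ℕ) : Setoid (DoublyEvenSelfDualCode N₁ N₂) where
  r C D := Equivalent C.1 D.1
  iseqv :=
    { refl := fun C => ⟨1, 1, fun c => by
        have h : (fun p => c (Sum.map (1 : Equiv.Perm (Fin N₁)) (1 : Equiv.Perm (Fin N₂)) p)) = c := by
          funext p; cases p <;> rfl
        rw [h]⟩
      symm := by
        rintro C D ⟨σ, τ, h⟩
        refine ⟨σ⁻¹, τ⁻¹, fun c => ?_⟩
        rw [h]
        have e : (fun p => (fun q => c (Sum.map (σ⁻¹ : Equiv.Perm (Fin N₁))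
            (τ⁻¹ : Equiv.Perm (Fin N₂)) q)) (Sum.map σ τ p)) = c := by
          funext p; cases p <;> simp
        rw [e]
      trans := by
        rintro C D E ⟨σ, τ, h⟩ ⟨σ', τ', h'⟩
        refine ⟨σ' * σ, τ' * τ, fun c => ?_⟩
        rw [h', h]
        have e : (fun p => (fun q => c (Sum.map σ' τ' q)) (Sum.map σ τ p)) =
            fun p => c (Sum.map (σ' * σ : Equiv.Perm (Fin N₁)) (τ' * τ : Equiv.Perm (Fin N₂)) p) := by
          funext p; cases p <;> simp
        rw [e] }

/-! ### Conjugate polynomials and weight enumerators -/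

/-- The index set `𝔽₂^m` of the variables (the additive group of the field with `2^m` elements). -/
abbrev Idx (m : ℕ) : Type := Fin m → ZMod 2

/-- `ℂ[x_f, x̄_f | f ∈ V]`: the variable `x_f` is `X (Sum.inl f)`, and `x̄_f` is `X (Sum.inr f)`. -/
abbrev ConjPoly (V : Type) : Type := MvPolynomial (V ⊕ V) ℂ

/-- The bidegree of a variable: `(1, 0)` for `x_f` and `(0, 1)` for `x̄_f`. -/
def bidegree (V : Type) : V ⊕ V → ℕ × ℕ := Sum.elim (fun _ => (1, 0)) (fun _ => (0, 1))

/-- The code `C(m)` over the alphabet `𝔽₂^m`: its words are the `m × (N₁ + N₂)` binary matrices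
all of whose rows lie in `C`, a matrix being read as the word formed by its columns. -/
def extendCode (m : ℕ) {N₁ N₂ : ℕ} (C : BinaryCode N₁ N₂) :
    Submodule (ZMod 2) (Pos N₁ N₂ → Idx m) where
  carrier := {M | ∀ k : Fin m, (fun p => M p k) ∈ C}
  zero_mem' := fun _ => C.zero_mem
  add_mem' := fun hM hM' k => C.add_mem (hM k) (hM' k)
  smul_mem' := fun a _ hM k => C.smul_mem a (hM k)

/-- The conjugate monomial `x_{c_1} ⋯ x_{c_{N₁}} x̄_{c_{N₁+1}} ⋯ x̄_{c_{N₁+N₂}}` of a word `c`. -/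
noncomputable def conjMonomial {V : Type} {N₁ N₂ : ℕ} (c : Pos N₁ N₂ → V) : ConjPoly V :=
  (∏ i, MvPolynomial.X (Sum.inl (c (Sum.inl i)))) * ∏ j, MvPolynomial.X (Sum.inr (c (Sum.inr j)))

open Classical in
/-- The complete conjugate weight enumerator of a code over the alphabet `V`. -/
noncomputable def ccwe {V : Type} [Fintype V] [AddCommGroup V] [Module (ZMod 2) V] {N₁ N₂ : ℕ}
    (C : Submodule (ZMod 2) (Pos N₁ N₂ → V)) : ConjPoly V :=
  ∑ c ∈ Finset.univ.filter (fun c => c ∈ C), conjMonomial c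

/-! ### The complex Clifford group -/

/-- The integer vector with entries `0, 1` that lifts `v ∈ 𝔽₂^m`. -/
def lift {m : ℕ} (v : Idx m) : Fin m → ℤ := fun k => ((v k).val : ℤ)

/-- The matrix of `d_S`, where `d_S e_v = i^{S[v]} e_v` and `S[v] = vᵀ S v`. -/
noncomputable def diagonalMatrix {m : ℕ} (S : Matrix (Fin m) (Fin m) ℤ) :
    Matrix (Idx m) (Idx m) ℂ :=
  Matrix.diagonal fun v => Complex.I ^ (lift v ⬝ᵥ S.mulVec (lift v))

/-- The matrix of `m_{g,v'}`, where `m_{g,v'} e_v = e_{gv+v'}`. -/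
noncomputable def affineMatrix {m : ℕ} (g : GL (Fin m) (ZMod 2)) (v' : Idx m) :
    Matrix (Idx m) (Idx m) ℂ :=
  Matrix.of fun w v => if w = g.1.mulVec v + v' then 1 else 0

/-- The `2 × 2` matrix `h = (1/√2) [1, 1; 1, -1]`. -/
noncomputable def hadamard : Matrix (ZMod 2) (ZMod 2) ℂ :=
  Matrix.of fun a b => (1 / (Real.sqrt 2 : ℂ)) * (if a = 1 ∧ b = 1 then -1 else 1)

/-- The matrix of `h ⊗ I₂ ⊗ ⋯ ⊗ I₂`, with `h` acting on the first tensor factor. -/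
noncomputable def hadamardMatrix (m : ℕ) [NeZero m] : Matrix (Idx m) (Idx m) ℂ :=
  Matrix.of fun w v => ∏ k : Fin m,
    (if k = 0 then hadamard else (1 : Matrix (ZMod 2) (ZMod 2) ℂ)) (w k) (v k)

theorem diagonalMatrix_mem {m : ℕ} (S : Matrix (Fin m) (Fin m) ℤ) :
    diagonalMatrix S ∈ Matrix.unitaryGroup (Idx m) ℂ := by
  rw [Matrix.mem_unitaryGroup_iff, diagonalMatrix, Matrix.star_eq_conjTranspose,
    Matrix.diagonal_conjTranspose, Matrix.diagonal_mul_diagonal, ← Matrix.diagonal_one]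
  congr 1
  funext v
  simp [star_zpow₀, ← mul_zpow]

theorem affineMatrix_mem {m : ℕ} (g : GL (Fin m) (ZMod 2)) (v' : Idx m) :
    affineMatrix g v' ∈ Matrix.unitaryGroup (Idx m) ℂ := by
  rw [Matrix.mem_unitaryGroup_iff']
  ext a b
  have hinj : ∀ a b : Idx m, g.1.mulVec a + v' = g.1.mulVec b + v' ↔ a = b := by
    intro a b
    rw [add_left_inj]
    exact (Matrix.mulVec_injective_of_isUnit g.isUnit).eq_iff
  simp [affineMatrix, Matrix.mul_apply, Matrix.one_apply, Matrix.star_apply, hinj, eq_comm]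

theorem hadamardMatrix_mem (m : ℕ) [NeZero m] :
    hadamardMatrix m ∈ Matrix.unitaryGroup (Idx m) ℂ := by
  have hs : ((Real.sqrt 2 : ℝ) : ℂ) * ((Real.sqrt 2 : ℝ) : ℂ) = 2 := by
    rw [← Complex.ofReal_mul, Real.mul_self_sqrt (by norm_num)]
    norm_num
  have hs' : ((Real.sqrt 2 : ℝ) : ℂ)⁻¹ * ((Real.sqrt 2 : ℝ) : ℂ)⁻¹ = 1 / 2 := by
    rw [← mul_inv, hs]
    norm_num
  have h0 : ∀ a b : ZMod 2, ∑ x, hadamard a x * star (hadamard b x) =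
      (1 : Matrix (ZMod 2) (ZMod 2) ℂ) a b := by
    intro a b
    have hu : (Finset.univ : Finset (ZMod 2)) = {0, 1} := rfl
    rw [hu, Finset.sum_pair (by decide)]
    have hc : ∀ a : ZMod 2, a = 0 ∨ a = 1 := by decide
    rcases hc a with rfl | rfl <;> rcases hc b with rfl | rfl <;>
      simp [hadamard, Matrix.one_apply, hs'] <;> norm_num
  have h1 : ∀ a b : ZMod 2, ∑ x, (1 : Matrix (ZMod 2) (ZMod 2) ℂ) a x *
      star ((1 : Matrix (ZMod 2) (ZMod 2) ℂ) b x) = (1 : Matrix (ZMod 2) (ZMod 2) ℂ) a b := by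
    intro a b
    simp [Matrix.one_apply]
  rw [Matrix.mem_unitaryGroup_iff]
  ext a b
  simp only [Matrix.mul_apply, Matrix.star_apply, hadamardMatrix, Matrix.of_apply, star_prod,
    ← Finset.prod_mul_distrib]
  rw [← Fintype.prod_sum fun (k : Fin m) (x : ZMod 2) =>
    (if k = 0 then hadamard else (1 : Matrix (ZMod 2) (ZMod 2) ℂ)) (a k) x *
      star ((if k = 0 then hadamard else (1 : Matrix (ZMod 2) (ZMod 2) ℂ)) (b k) x)]
  have h2 : ∀ k : Fin m, ∑ x : ZMod 2,
      (if k = 0 then hadamard else (1 : Matrix (ZMod 2) (ZMod 2) ℂ)) (a k) x *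
        star ((if k = 0 then hadamard else (1 : Matrix (ZMod 2) (ZMod 2) ℂ)) (b k) x) =
      if a k = b k then 1 else 0 := by
    intro k
    split_ifs with hk hab hab
    · rw [h0, hab, Matrix.one_apply_eq]
    · rw [h0, Matrix.one_apply_ne hab]
    · rw [h1, hab, Matrix.one_apply_eq]
    · rw [h1, Matrix.one_apply_ne hab]
  simp only [h2, Finset.prod_ite_zero, Matrix.one_apply, funext_iff]
  simp

/-- The complex Clifford group `𝒳_m` of genus `m`. -/
noncomputable def cliffordGroup (m : ℕ) [NeZero m] : Subgroup (Matrix.unitaryGroup (Idx m) ℂ) :=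
  Subgroup.closure
    ({U | ∃ S : Matrix (Fin m) (Fin m) ℤ, S.IsSymm ∧ U = ⟨diagonalMatrix S, diagonalMatrix_mem S⟩} ∪
      {U | ∃ (g : GL (Fin m) (ZMod 2)) (v' : Idx m), U = ⟨affineMatrix g v', affineMatrix_mem g v'⟩} ∪
      {⟨hadamardMatrix m, hadamardMatrix_mem m⟩})

/-- The action of a matrix `U` on conjugate polynomials, by the algebra endomorphism with
`x_v ↦ ∑ w, U_{wv} x_w` (as `U e_v = ∑ w, U_{wv} e_w`) and `x̄_v ↦ ∑ w, conj U_{wv} x̄_w`. -/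
noncomputable def conjAction {V : Type} [Fintype V] (U : Matrix V V ℂ) :
    ConjPoly V →ₐ[ℂ] ConjPoly V :=
  MvPolynomial.aeval (Sum.elim
    (fun v => ∑ w, MvPolynomial.C (U w v) * MvPolynomial.X (Sum.inl w))
    (fun v => ∑ w, MvPolynomial.C (star (U w v)) * MvPolynomial.X (Sum.inr w)))

/-- The space of complex Clifford invariants of genus `m`, homogeneous of degree `(N₁, N₂)`. -/
noncomputable def cliffordInvariants (m : ℕ) [NeZero m] (N₁ N₂ : ℕ) :
    Submodule ℂ (ConjPoly (Idx m)) where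
  carrier := {p | MvPolynomial.IsWeightedHomogeneous (bidegree (Idx m)) p (N₁, N₂) ∧
    ∀ U ∈ cliffordGroup m, conjAction (U : Matrix (Idx m) (Idx m) ℂ) p = p}
  zero_mem' := ⟨MvPolynomial.isWeightedHomogeneous_zero ℂ _ _, fun _ _ => map_zero _⟩
  add_mem' := fun hp hq => ⟨hp.1.add hq.1, fun U hU => by rw [map_add, hp.2 U hU, hq.2 U hU]⟩
  smul_mem' := fun a p hp =>
    ⟨(MvPolynomial.weightedHomogeneousSubmodule ℂ (bidegree (Idx m)) (N₁, N₂)).smul_mem a hp.1,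
      fun U hU => by rw [map_smul, hp.2 U hU]⟩

end CliffordCodes

namespace CliffordCodes

/-! ### Linear maps with the same range -/

/-! Every conjugate polynomial of bidegree `(N₁, N₂)` is `toPoly f` for a tensor `f` on words, and
the generators act compatibly on tensors. The tensor `f` of an invariant polynomial need not be
invariant, but it may be replaced by its image under any averaging of generators without changing
`toPoly f`. The diagonal and affine elements together allow the restriction of `f` to words whose
row code `wordCode` (rows and the all-one word) is doubly-even (`IsInvariant.toPoly_evenPart`),
followed by the average over the affine group. Affine orbits of words are exactly the fibres of
`wordCode` (`exists_affineAct_eq`), so Möbius inversion puts the new `f` in the span of the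
indicators `codeInd m C`, with `C` doubly-even and containing the all-one word
(`mem_span_codeInd_of_invariant`).

It remains to use the Hadamard matrix. Let `T` be its action followed by the two projections above
(`projectedHadamard`); then `toPoly (T f) = toPoly f` as well. The Hadamard matrix is a Fourier
transform in the first row, so it turns `C` into its dual in that row, with factor `|C| /
2^((N₁+N₂)/2)`. Hence `T` is triangular for inclusion: `T (codeInd m C)` is `a • codeInd m C` plus
indicators of strictly larger codes, and `a < 1` unless `C` is self-dual
(`exists_projectedHadamard_codeInd_sub_mem`). For a minimal `C` occurring in `f`, either `C` is
self-dual and its term, being invariant, splits off, or `(1 - a)⁻¹ • (T f - a • f)` gives the same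
polynomial without `C`. Induction leaves only self-dual codes (`toPoly_mem_span_of_upperSet`).

For independence, a self-dual `C` has dimension at most `m + 1` and contains the all-one word, so
some word `M₀` of `C(m)` has row code `C`. Its monomial occurs in the enumerator of `D(m)` only if a
coordinate permutation carries `C` into `D`, hence onto `D` by dimension. These monomials therefore
separate the classes. -/

theorem nonempty_compl_ker_linearEquiv_range {K V W : Type*} [Field K] [AddCommGroup V]
    [Module K V] [AddCommGroup W] [Module K W] (f : V →ₗ[K] W) {P : Submodule K V}
    (hP : IsCompl (LinearMap.ker f) P) :
    ∃ e : P ≃ₗ[K] LinearMap.range f, ∀ x : P, (e x : W) = f x := by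
  refine ⟨LinearEquiv.ofBijective (f.rangeRestrict ∘ₗ P.subtype) ⟨?_, ?_⟩, fun x => rfl⟩
  · rw [← LinearMap.ker_eq_bot, LinearMap.ker_comp, LinearMap.ker_rangeRestrict]
    exact Submodule.disjoint_iff_comap_eq_bot.1 hP.symm.disjoint
  · rintro ⟨_, x, rfl⟩
    obtain ⟨a, ha, b, hb, rfl⟩ := Submodule.mem_sup.1
      (hP.sup_eq_top.symm ▸ Submodule.mem_top : x ∈ LinearMap.ker f ⊔ P)
    exact ⟨⟨b, hb⟩, Subtype.ext (by simp [LinearMap.mem_ker.1 ha])⟩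

/-- The kernels have equal dimension by rank-nullity, and complements of the kernels both map
isomorphically onto the common range; the two isomorphisms are glued. Applied to row maps, `e`
becomes the element of `GL(m,2)` that moves one word to another. -/
theorem exists_linearEquiv_comp_eq_of_range_eq {K V W : Type*} [Field K] [AddCommGroup V]
    [Module K V] [FiniteDimensional K V] [AddCommGroup W] [Module K W] (f f' : V →ₗ[K] W)
    (h : LinearMap.range f = LinearMap.range f') : ∃ e : V ≃ₗ[K] V, ∀ x, f (e x) = f' x := by
  obtain ⟨P, hP⟩ := Submodule.exists_isCompl (LinearMap.ker f)
  obtain ⟨P', hP'⟩ := Submodule.exists_isCompl (LinearMap.ker f')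
  have hk : Module.finrank K (LinearMap.ker f') = Module.finrank K (LinearMap.ker f) := by
    have h1 := LinearMap.finrank_range_add_finrank_ker f
    have h2 := LinearMap.finrank_range_add_finrank_ker f'
    rw [h] at h1
    omega
  obtain ⟨a, ha⟩ := nonempty_compl_ker_linearEquiv_range f hP
  obtain ⟨a', ha'⟩ := nonempty_compl_ker_linearEquiv_range f' hP'
  let c : P' ≃ₗ[K] P := a' ≪≫ₗ LinearEquiv.ofEq _ _ h.symm ≪≫ₗ a.symm
  have hc : ∀ x : P', f (c x) = f' x := by
    intro x
    rw [← ha, ← ha']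
    simp [c]
  let s := Submodule.prodEquivOfIsCompl _ _ hP
  let s' := Submodule.prodEquivOfIsCompl _ _ hP'
  refine ⟨s'.symm ≪≫ₗ LinearEquiv.prodCongr (LinearEquiv.ofFinrankEq _ _ hk) c ≪≫ₗ s, fun x => ?_⟩
  obtain ⟨y, rfl⟩ := s'.surjective x
  simp [s, s', hc]

/-! ### Signs, weights and duality -/

/-- The sign `1` on the first `N₁` positions, `-1` on the last `N₂`. -/
def sign {N₁ N₂ : ℕ} : Pos N₁ N₂ → ℤ := Sum.elim (fun _ => 1) (fun _ => -1)

section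

variable {m N₁ N₂ : ℕ}

theorem wt_eq_sum (c : Pos N₁ N₂ → ZMod 2) : wt c = ∑ p, sign p * ((c p).val : ℤ) := by
  simp [wt, sign, Fintype.sum_sum_type, sub_eq_add_neg]

theorem beta_eq_dotProduct (x y : Pos N₁ N₂ → ZMod 2) : beta x y = x ⬝ᵥ y := by
  simp [beta, dotProduct, Fintype.sum_sum_type, CharTwo.sub_eq_add]

theorem mem_dualCode {C : BinaryCode N₁ N₂} {y : Pos N₁ N₂ → ZMod 2} :
    y ∈ dualCode C ↔ ∀ c ∈ C, c ⬝ᵥ y = 0 := by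
  simp only [← beta_eq_dotProduct]
  rfl

/-- The sum of signs over the common support of two words. -/
def overlap (x y : Pos N₁ N₂ → ZMod 2) : ℤ := ∑ p, sign p * ((x p).val * (y p).val : ℤ)

theorem overlap_cast (x y : Pos N₁ N₂ → ZMod 2) : (overlap x y : ZMod 2) = x ⬝ᵥ y := by
  simp [overlap, dotProduct, Fintype.sum_sum_type, sign]

theorem two_dvd_overlap {x y : Pos N₁ N₂ → ZMod 2} : 2 ∣ overlap x y ↔ x ⬝ᵥ y = 0 := by
  rw [← overlap_cast]
  exact (ZMod.intCast_zmod_eq_zero_iff_dvd _ 2).symm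

theorem overlap_self (x : Pos N₁ N₂ → ZMod 2) : overlap x x = wt x := by
  rw [wt_eq_sum]
  refine Finset.sum_congr rfl fun p _ => ?_
  have h : ∀ a : ZMod 2, ((a.val : ℤ) * a.val) = a.val := by decide
  rw [h]

theorem wt_add (x y : Pos N₁ N₂ → ZMod 2) : wt (x + y) = wt x + wt y - 2 * overlap x y := by
  simp only [wt_eq_sum, overlap, Finset.mul_sum, ← Finset.sum_add_distrib,
    ← Finset.sum_sub_distrib]
  refine Finset.sum_congr rfl fun p _ => ?_
  have h : ∀ a b : ZMod 2, ((a + b).val : ℤ) = a.val + b.val - 2 * (a.val * b.val) := by decide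
  rw [Pi.add_apply, h]
  ring

theorem wt_zero : wt (0 : Pos N₁ N₂ → ZMod 2) = 0 := by simp [wt]

theorem dotProduct_one_eq_wt (x : Pos N₁ N₂ → ZMod 2) : x ⬝ᵥ 1 = (wt x : ZMod 2) := by
  simp [wt_eq_sum, dotProduct, Fintype.sum_sum_type, sign]

/-- By `wt_add`, twice the overlap is a combination of three weights divisible by `4`. -/
theorem IsDoublyEven.dotProduct_eq_zero {C : BinaryCode N₁ N₂} (hC : IsDoublyEven C)
    {x y : Pos N₁ N₂ → ZMod 2} (hx : x ∈ C) (hy : y ∈ C) : x ⬝ᵥ y = 0 := by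
  have h1 := hC _ hx
  have h2 := hC _ hy
  have h3 := hC _ (C.add_mem hx hy)
  rw [wt_add] at h3
  rw [← two_dvd_overlap]
  omega

theorem IsDoublyEven.le_dualCode {C : BinaryCode N₁ N₂} (hC : IsDoublyEven C) :
    C ≤ dualCode C :=
  fun _ hy => mem_dualCode.2 fun _ hc => hC.dotProduct_eq_zero hc hy

theorem one_mem_of_selfDual {C : BinaryCode N₁ N₂} (hC : IsDoublyEven C) (hC' : IsSelfDual C) :
    (1 : Pos N₁ N₂ → ZMod 2) ∈ C := by
  rw [hC', mem_dualCode]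
  intro c hc
  rw [dotProduct_one_eq_wt]
  exact (ZMod.intCast_zmod_eq_zero_iff_dvd _ 2).2 ((by norm_num : (2 : ℤ) ∣ 4).trans (hC c hc))

theorem finrank_add_finrank_dualCode (C : BinaryCode N₁ N₂) :
    Module.finrank (ZMod 2) C + Module.finrank (ZMod 2) (dualCode C) = N₁ + N₂ := by
  let B : LinearMap.BilinForm (ZMod 2) (Pos N₁ N₂ → ZMod 2) := dotProductBilin (ZMod 2) (ZMod 2)
  have hB : LinearMap.ker B = ⊥ := by
    rw [LinearMap.ker_eq_bot']
    intro x hx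
    funext p
    simpa [B] using LinearMap.congr_fun hx (Pi.single p 1)
  have h := LinearMap.BilinForm.finrank_add_finrank_orthogonal' (B := B) C
  have hd : B.orthogonal C = dualCode C := by
    ext y
    rw [mem_dualCode, LinearMap.BilinForm.mem_orthogonal_iff]
    rfl
  rw [hB, hd] at h
  erw [inf_bot_eq, finrank_bot] at h
  simpa using h

theorem natCard_code (C : BinaryCode N₁ N₂) :
    Nat.card C = 2 ^ Module.finrank (ZMod 2) C := by
  have := Module.natCard_eq_pow_finrank (K := ZMod 2) (V := C)
  simpa using this

/-- The ratio of the size of a code to the size of a self-dual code. -/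
noncomputable def sizeRatio (C : BinaryCode N₁ N₂) : ℝ :=
  (1 / Real.sqrt 2) ^ (N₁ + N₂) * Nat.card C

/-- This is `|C| * |C^⊥| = 2^(N₁+N₂)` in disguise. It makes the ratio `1` for self-dual codes and
less than `1` for codes properly inside their dual. -/
theorem sizeRatio_sq (C : BinaryCode N₁ N₂) :
    sizeRatio C ^ 2 * Nat.card (dualCode C) = Nat.card C := by
  have h : ((1 / Real.sqrt 2) ^ (N₁ + N₂)) ^ 2 * (2 : ℝ) ^ (N₁ + N₂) = 1 := by
    rw [← pow_mul, mul_comm, mul_comm (N₁ + N₂), pow_mul, ← mul_pow]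
    norm_num
  rw [sizeRatio, mul_pow]
  rw [← finrank_add_finrank_dualCode C, pow_add 2] at h
  simp only [natCard_code, Nat.cast_pow, Nat.cast_ofNat]
  rw [← finrank_add_finrank_dualCode C]
  linear_combination (2 : ℝ) ^ Module.finrank (ZMod 2) C * h

theorem sizeRatio_nonneg (C : BinaryCode N₁ N₂) : 0 ≤ sizeRatio C := by
  unfold sizeRatio
  positivity

theorem sizeRatio_eq_one {C : BinaryCode N₁ N₂} (h : IsSelfDual C) : sizeRatio C = 1 := by
  have h1 := sizeRatio_sq C
  have h2 : (0 : ℝ) < Nat.card C := by exact_mod_cast Nat.card_pos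
  rw [← h] at h1
  have h3 : sizeRatio C ^ 2 = 1 := mul_right_cancel₀ h2.ne' (by rw [h1, one_mul])
  nlinarith [sizeRatio_nonneg C]

theorem sizeRatio_lt_one {C : BinaryCode N₁ N₂} (h : C < dualCode C) : sizeRatio C < 1 := by
  have h1 := sizeRatio_sq C
  have h2 : (0 : ℝ) < Nat.card C := by exact_mod_cast Nat.card_pos
  have h3 : (Nat.card C : ℝ) < Nat.card (dualCode C) := by
    simp only [natCard_code]
    have := Submodule.finrank_lt_finrank_of_lt h
    exact_mod_cast Nat.pow_lt_pow_right (by norm_num) this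
  by_contra hc
  push Not at hc
  have h4 : 1 ≤ sizeRatio C ^ 2 := one_le_pow₀ hc
  nlinarith

end


/-! ### Conjugate polynomials as images of tensors -/

/-- Words of length `(N₁, N₂)` over `𝔽₂^m`. -/
abbrev Word (m N₁ N₂ : ℕ) : Type := Pos N₁ N₂ → Idx m

/-- The variable that the letter `v` contributes at position `p`. -/
def letterIndex {V : Type} {N₁ N₂ : ℕ} (p : Pos N₁ N₂) (v : V) : V ⊕ V :=
  Sum.elim (fun _ => Sum.inl v) (fun _ => Sum.inr v) p

/-- The matrix `U` on the first `N₁` positions and its entrywise conjugate on the others. -/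
noncomputable def entry {V : Type} {N₁ N₂ : ℕ} (U : Matrix V V ℂ) (p : Pos N₁ N₂) :
    Matrix V V ℂ :=
  Sum.elim (fun _ => U) (fun _ => U.map star) p

section

variable {m N₁ N₂ : ℕ}

theorem conjMonomial_eq_prod {V : Type} (c : Pos N₁ N₂ → V) :
    conjMonomial c = ∏ p, MvPolynomial.X (R := ℂ) (letterIndex p (c p)) := by
  simp [conjMonomial, letterIndex, Fintype.prod_sum_type]

theorem conjAction_X_letterIndex {V : Type} [Fintype V] (U : Matrix V V ℂ) (p : Pos N₁ N₂) (v : V) :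
    conjAction U (MvPolynomial.X (letterIndex p v)) =
      ∑ w, MvPolynomial.C (entry U p w v) * MvPolynomial.X (letterIndex p w) := by
  cases p <;> simp [conjAction, letterIndex, entry]

theorem conjAction_conjMonomial {V : Type} [Fintype V] (U : Matrix V V ℂ)
    (c : Pos N₁ N₂ → V) :
    conjAction U (conjMonomial c) =
      ∑ w : Pos N₁ N₂ → V, (∏ p, entry U p (w p) (c p)) • conjMonomial w := by
  classical
  simp only [conjMonomial_eq_prod, map_prod, conjAction_X_letterIndex]
  rw [Fintype.prod_sum]
  simp only [Finset.prod_mul_distrib, ← map_prod, MvPolynomial.smul_eq_C_mul]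

theorem conjAction_one {V : Type} [Fintype V] [DecidableEq V] :
    conjAction (1 : Matrix V V ℂ) = AlgHom.id ℂ _ := by
  refine MvPolynomial.algHom_ext fun i => ?_
  cases i <;> simp [conjAction, Matrix.one_apply, apply_ite]

theorem conjAction_mul {V : Type} [Fintype V] (U W : Matrix V V ℂ) :
    conjAction (U * W) = (conjAction U).comp (conjAction W) := by
  refine MvPolynomial.algHom_ext fun i => ?_
  cases i with
  | inl v =>
    simp only [conjAction, AlgHom.comp_apply, MvPolynomial.aeval_X, Sum.elim_inl, map_sum, map_mul,
      Matrix.mul_apply, MvPolynomial.algHom_C, MvPolynomial.algebraMap_eq, Finset.sum_mul,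
      Finset.mul_sum]
    rw [Finset.sum_comm]
    exact Finset.sum_congr rfl fun _ _ => Finset.sum_congr rfl fun _ _ => by ring
  | inr v =>
    simp only [conjAction, AlgHom.comp_apply, MvPolynomial.aeval_X, Sum.elim_inr, map_sum, map_mul,
      Matrix.mul_apply, MvPolynomial.algHom_C, MvPolynomial.algebraMap_eq, Finset.sum_mul,
      Finset.mul_sum, star_sum, star_mul']
    rw [Finset.sum_comm]
    exact Finset.sum_congr rfl fun _ _ => Finset.sum_congr rfl fun _ _ => by ring

/-- The conjugate polynomial `∑ f(c) x_c` of a tensor `f`. -/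
noncomputable def toPoly (m N₁ N₂ : ℕ) : (Word m N₁ N₂ → ℂ) →ₗ[ℂ] ConjPoly (Idx m) :=
  Fintype.linearCombination ℂ conjMonomial

theorem toPoly_apply (f : Word m N₁ N₂ → ℂ) :
    toPoly m N₁ N₂ f = ∑ c, f c • conjMonomial c := rfl

theorem exists_word_of_multiplicities {V : Type} [Fintype V] (n : ℕ) (e : V → ℕ)
    (h : ∑ v, e v = n) :
    ∃ c : Fin n → V, ∀ g : V → MvPolynomial (V ⊕ V) ℂ, ∏ i, g (c i) = ∏ v, g v ^ e v := by
  have hc : Fintype.card (Fin n) = Fintype.card (Σ v, Fin (e v)) := by simp [h]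
  refine ⟨fun i => (Fintype.equivOfCardEq hc i).1, fun g => ?_⟩
  rw [(Fintype.equivOfCardEq hc).prod_comp (fun x => g x.1), Fintype.prod_sigma]
  simp

/-- A monomial of this bidegree is the monomial of any word that lists its variables with
multiplicity, unbarred letters in the first block and barred ones in the second. -/
theorem exists_toPoly_eq {p : ConjPoly (Idx m)}
    (hp : MvPolynomial.IsWeightedHomogeneous (bidegree (Idx m)) p (N₁, N₂)) :
    ∃ f, toPoly m N₁ N₂ f = p := by
  change p ∈ LinearMap.range (toPoly m N₁ N₂)
  rw [MvPolynomial.as_sum p]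
  refine Submodule.sum_mem _ fun s hs => ?_
  have hw := hp (MvPolynomial.mem_support_iff.1 hs)
  rw [Finsupp.weight_apply, Finsupp.sum_fintype _ _ (by simp), Fintype.sum_sum_type] at hw
  have h1 : ∑ v, s (Sum.inl v) = N₁ := by
    simpa [bidegree, Prod.fst_sum] using congrArg Prod.fst hw
  have h2 : ∑ v, s (Sum.inr v) = N₂ := by
    simpa [bidegree, Prod.snd_sum] using congrArg Prod.snd hw
  obtain ⟨c₁, hc₁⟩ := exists_word_of_multiplicities N₁ (fun v => s (Sum.inl v)) h1
  obtain ⟨c₂, hc₂⟩ := exists_word_of_multiplicities N₂ (fun v => s (Sum.inr v)) h2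
  have hm : MvPolynomial.monomial s (MvPolynomial.coeff s p) =
      MvPolynomial.coeff s p • conjMonomial (N₁ := N₁) (N₂ := N₂) (Sum.elim c₁ c₂) := by
    rw [MvPolynomial.monomial_eq, Finsupp.prod_fintype _ _ (by simp), Fintype.prod_sum_type,
      MvPolynomial.smul_eq_C_mul, conjMonomial]
    simp only [Sum.elim_inl, Sum.elim_inr]
    rw [hc₁ (fun v => MvPolynomial.X (Sum.inl v)), hc₂ (fun v => MvPolynomial.X (Sum.inr v))]
  rw [hm]
  refine Submodule.smul_mem _ _ ⟨Pi.single (Sum.elim c₁ c₂) 1, ?_⟩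
  simp [toPoly, Fintype.linearCombination_apply_single]

theorem isWeightedHomogeneous_toPoly (f : Word m N₁ N₂ → ℂ) :
    MvPolynomial.IsWeightedHomogeneous (bidegree (Idx m)) (toPoly m N₁ N₂ f) (N₁, N₂) := by
  rw [toPoly_apply]
  refine MvPolynomial.IsWeightedHomogeneous.sum _ _ _ fun c _ => ?_
  rw [MvPolynomial.smul_eq_C_mul, conjMonomial_eq_prod]
  refine MvPolynomial.IsWeightedHomogeneous.C_mul ?_ _
  have h : ((N₁, N₂) : ℕ × ℕ) = ∑ p : Pos N₁ N₂, bidegree (Idx m) (letterIndex p (c p)) := by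
    ext <;> simp [Fintype.sum_sum_type, bidegree, letterIndex]
  rw [h]
  exact MvPolynomial.IsWeightedHomogeneous.prod _ _ _ fun p _ =>
    MvPolynomial.isWeightedHomogeneous_X _ _ _

/-! ### The generators acting on tensors -/

/-- The affine map `v ↦ g v + v'` applied to every letter of a word. -/
def affineAct (g : GL (Fin m) (ZMod 2)) (v' : Idx m) (M : Word m N₁ N₂) : Word m N₁ N₂ :=
  fun p => g.1.mulVec (M p) + v'

theorem affineAct_affineAct (g g' : GL (Fin m) (ZMod 2)) (v v' : Idx m) (M : Word m N₁ N₂) :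
    affineAct g v (affineAct g' v' M) = affineAct (g * g') (g.1.mulVec v' + v) M := by
  funext p
  simp [affineAct, Matrix.mulVec_add, add_assoc]

theorem affineAct_one_zero (M : Word m N₁ N₂) : affineAct 1 0 M = M := by
  funext p
  simp [affineAct]

theorem affineAct_inv_affineAct (g : GL (Fin m) (ZMod 2)) (v : Idx m) (M : Word m N₁ N₂) :
    affineAct g⁻¹ (-(g⁻¹).1.mulVec v) (affineAct g v M) = M := by
  rw [affineAct_affineAct, inv_mul_cancel, add_neg_cancel, affineAct_one_zero]

theorem affineAct_affineAct_inv (g : GL (Fin m) (ZMod 2)) (v : Idx m) (M : Word m N₁ N₂) :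
    affineAct g v (affineAct g⁻¹ (-(g⁻¹).1.mulVec v) M) = M := by
  rw [affineAct_affineAct, mul_inv_cancel, Matrix.mulVec_neg, Matrix.mulVec_mulVec,
    ← Units.val_mul, mul_inv_cancel]
  simp [affineAct_one_zero]

/-- `affineAct` as a permutation of the words. -/
def affinePerm (g : GL (Fin m) (ZMod 2)) (v : Idx m) :
    Equiv.Perm (Word m N₁ N₂) where
  toFun := affineAct g v
  invFun := affineAct g⁻¹ (-(g⁻¹).1.mulVec v)
  left_inv := affineAct_inv_affineAct g v
  right_inv := affineAct_affineAct_inv g v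

theorem conjAction_affineMatrix (g : GL (Fin m) (ZMod 2)) (v : Idx m) (c : Word m N₁ N₂) :
    conjAction (affineMatrix g v) (conjMonomial c) = conjMonomial (affineAct g v c) := by
  simp only [conjMonomial_eq_prod, map_prod, conjAction_X_letterIndex]
  refine Finset.prod_congr rfl fun p _ => ?_
  cases p <;> simp [entry, affineMatrix, affineAct, apply_ite]

theorem conjAction_affineMatrix_toPoly (g : GL (Fin m) (ZMod 2)) (v : Idx m)
    (f : Word m N₁ N₂ → ℂ) :
    conjAction (affineMatrix g v) (toPoly m N₁ N₂ (fun M => f (affineAct g v M))) =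
      toPoly m N₁ N₂ f := by
  simp only [toPoly_apply, map_sum, map_smul, conjAction_affineMatrix]
  exact Equiv.sum_comp (affinePerm g v) (fun M => f M • conjMonomial M)

/-- The exponent of `i` by which `d_S` acts on the monomial of a word. -/
def phase (S : Matrix (Fin m) (Fin m) ℤ) (c : Word m N₁ N₂) : ℤ :=
  ∑ p, sign p * (lift (c p) ⬝ᵥ S.mulVec (lift (c p)))

theorem conjAction_diagonalMatrix (S : Matrix (Fin m) (Fin m) ℤ) (c : Word m N₁ N₂) :
    conjAction (diagonalMatrix S) (conjMonomial c) = Complex.I ^ phase S c • conjMonomial c := by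
  have hprod : ∀ (s : Finset (Pos N₁ N₂)) (a : Pos N₁ N₂ → ℤ),
      Complex.I ^ (∑ p ∈ s, a p) = ∏ p ∈ s, Complex.I ^ a p := by
    intro s a
    induction s using Finset.cons_induction with
    | empty => simp
    | cons x s hx ih => rw [Finset.sum_cons, Finset.prod_cons, zpow_add₀ Complex.I_ne_zero, ih]
  simp only [conjMonomial_eq_prod, map_prod, conjAction_X_letterIndex, phase, hprod,
    MvPolynomial.smul_eq_C_mul, ← Finset.prod_mul_distrib]
  refine Finset.prod_congr rfl fun p _ => ?_
  cases p
  · simp [entry, diagonalMatrix, sign, Matrix.diagonal_apply, apply_ite]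
  · simp [entry, diagonalMatrix, sign, Matrix.diagonal_apply, apply_ite]
    -- On the last `N₂` positions the conjugate entry is `(-i)^n = i^(-n)`, which is the source of
    -- the negative sign in `phase`.
    rw [← Complex.inv_I, inv_zpow]

theorem conjAction_diagonalMatrix_toPoly (S : Matrix (Fin m) (Fin m) ℤ)
    (f : Word m N₁ N₂ → ℂ) :
    conjAction (diagonalMatrix S) (toPoly m N₁ N₂ f) =
      toPoly m N₁ N₂ (fun M => Complex.I ^ phase S M * f M) := by
  simp only [toPoly_apply, map_sum, map_smul, conjAction_diagonalMatrix, smul_smul]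
  exact Finset.sum_congr rfl fun M _ => by rw [mul_comm]

/-- The Hadamard matrix acting on tensors. -/
noncomputable def hadamardAct (m N₁ N₂ : ℕ) [NeZero m] :
    (Word m N₁ N₂ → ℂ) →ₗ[ℂ] (Word m N₁ N₂ → ℂ) :=
  Matrix.mulVecLin (Matrix.of fun w c => ∏ p, entry (hadamardMatrix m) p (w p) (c p))

theorem conjAction_hadamardMatrix_toPoly [NeZero m] (f : Word m N₁ N₂ → ℂ) :
    conjAction (hadamardMatrix m) (toPoly m N₁ N₂ f) = toPoly m N₁ N₂ (hadamardAct m N₁ N₂ f) := by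
  simp only [toPoly_apply, map_sum, map_smul, conjAction_conjMonomial, hadamardAct,
    Matrix.mulVecLin_apply, Matrix.mulVec, dotProduct, Matrix.of_apply, Finset.smul_sum,
    Finset.sum_smul, smul_smul]
  rw [Finset.sum_comm]
  exact Finset.sum_congr rfl fun w _ => Finset.sum_congr rfl fun c _ => by rw [mul_comm]

end


section

variable {m N₁ N₂ : ℕ}

/-! ### The code generated by the rows of a word -/

/-- The linear combinations of the rows of a word, read as an `m × (N₁ + N₂)` matrix. -/
def rowMap (M : Word m N₁ N₂) : Idx m →ₗ[ZMod 2] (Pos N₁ N₂ → ZMod 2) where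
  toFun a := fun p => a ⬝ᵥ M p
  map_add' a b := by funext p; simp [add_dotProduct]
  map_smul' a b := by funext p; simp

theorem rowMap_apply (M : Word m N₁ N₂) (a : Idx m) (p : Pos N₁ N₂) :
    rowMap M a p = a ⬝ᵥ M p := rfl

theorem rowMap_single (M : Word m N₁ N₂) (k : Fin m) :
    rowMap M (Pi.single k 1) = fun p => M p k := by
  funext p
  simp [rowMap_apply]

theorem rowMap_affineAct (g : GL (Fin m) (ZMod 2)) (v : Idx m) (M : Word m N₁ N₂) (a : Idx m) :
    rowMap (affineAct g v M) a = rowMap M (Matrix.vecMul a g.1) + (a ⬝ᵥ v) • 1 := by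
  funext p
  simp [rowMap_apply, affineAct, dotProduct_add, Matrix.dotProduct_mulVec]

theorem rowMap_sub (M M' : Word m N₁ N₂) (a : Idx m) :
    rowMap (M - M') a = rowMap M a - rowMap M' a := by
  funext p
  simp [rowMap_apply, dotProduct_sub]

theorem mem_extendCode {C : BinaryCode N₁ N₂} {M : Word m N₁ N₂} :
    M ∈ extendCode m C ↔ ∀ k, (fun p => M p k) ∈ C := Iff.rfl

theorem mem_extendCode_iff_range_le {C : BinaryCode N₁ N₂} {M : Word m N₁ N₂} :
    M ∈ extendCode m C ↔ LinearMap.range (rowMap M) ≤ C := by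
  constructor
  · rintro h _ ⟨a, rfl⟩
    have : rowMap M a = ∑ k, a k • (fun p => M p k) := by
      funext p
      simp [rowMap_apply, dotProduct]
    rw [this]
    exact C.sum_mem fun k _ => C.smul_mem _ (h k)
  · intro h k
    rw [← rowMap_single]
    exact h (LinearMap.mem_range_self _ _)

/-- The code generated by the rows of a word and the all-one word. -/
def wordCode (M : Word m N₁ N₂) : BinaryCode N₁ N₂ :=
  LinearMap.range (rowMap M) ⊔ Submodule.span (ZMod 2) {1}

theorem one_mem_wordCode (M : Word m N₁ N₂) : 1 ∈ wordCode M :=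
  Submodule.mem_sup_right (Submodule.mem_span_singleton_self 1)

theorem rowMap_mem_wordCode (M : Word m N₁ N₂) (a : Idx m) : rowMap M a ∈ wordCode M :=
  Submodule.mem_sup_left (LinearMap.mem_range_self _ _)

theorem row_mem_wordCode (M : Word m N₁ N₂) (k : Fin m) : (fun p => M p k) ∈ wordCode M := by
  rw [← rowMap_single]
  exact rowMap_mem_wordCode M _

theorem wordCode_le_iff {C : BinaryCode N₁ N₂} (h1 : 1 ∈ C) {M : Word m N₁ N₂} :
    wordCode M ≤ C ↔ M ∈ extendCode m C := by
  rw [wordCode, sup_le_iff, mem_extendCode_iff_range_le, Submodule.span_singleton_le_iff_mem]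
  exact and_iff_left h1

theorem affineAct_mem {C : BinaryCode N₁ N₂} (h1 : 1 ∈ C) (g : GL (Fin m) (ZMod 2)) (v : Idx m)
    {M : Word m N₁ N₂} (h : M ∈ extendCode m C) : affineAct g v M ∈ extendCode m C := by
  rw [mem_extendCode_iff_range_le] at h ⊢
  rintro _ ⟨a, rfl⟩
  rw [rowMap_affineAct]
  exact C.add_mem (h (LinearMap.mem_range_self _ _)) (C.smul_mem _ h1)

theorem affineAct_mem_iff {C : BinaryCode N₁ N₂} (h1 : 1 ∈ C) (g : GL (Fin m) (ZMod 2))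
    (v : Idx m) {M : Word m N₁ N₂} : affineAct g v M ∈ extendCode m C ↔ M ∈ extendCode m C :=
  ⟨fun h => affineAct_inv_affineAct g v M ▸ affineAct_mem h1 _ _ h, affineAct_mem h1 g v⟩

theorem wordCode_affineAct (g : GL (Fin m) (ZMod 2)) (v : Idx m) (M : Word m N₁ N₂) :
    wordCode (affineAct g v M) = wordCode M := by
  apply le_antisymm
  · rw [wordCode_le_iff (one_mem_wordCode M), affineAct_mem_iff (one_mem_wordCode M),
      ← wordCode_le_iff (one_mem_wordCode M)]
  · rw [wordCode_le_iff (one_mem_wordCode _), ← affineAct_mem_iff (one_mem_wordCode _) g v,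
      ← wordCode_le_iff (one_mem_wordCode _)]

/-! ### Orbits of the affine group on words -/

theorem exists_gl_vecMul_eq (e : Idx m ≃ₗ[ZMod 2] Idx m) :
    ∃ g : GL (Fin m) (ZMod 2), ∀ a, Matrix.vecMul a g.1 = e a := by
  refine ⟨⟨(LinearMap.toMatrix' (e : Idx m →ₗ[ZMod 2] Idx m)).transpose,
    (LinearMap.toMatrix' (e.symm : Idx m →ₗ[ZMod 2] Idx m)).transpose, ?_, ?_⟩, fun a => ?_⟩
  · rw [← Matrix.transpose_mul, ← LinearMap.toMatrix'_comp]
    simp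
  · rw [← Matrix.transpose_mul, ← LinearMap.toMatrix'_comp]
    simp
  · rw [Matrix.vecMul_transpose, LinearMap.toMatrix'_mulVec]
    rfl

/-- The isomorphism between the lines spanned by the two nonzero vectors extends to an automorphism
of the whole space. -/
theorem exists_gl_row_eq [NeZero m] {a : Idx m} (ha : a ≠ 0) :
    ∃ g : GL (Fin m) (ZMod 2), Matrix.vecMul (Pi.single 0 1) g.1 = a := by
  have h0 : (Pi.single 0 1 : Idx m) ≠ 0 := by simp
  obtain ⟨e, he⟩ := Submodule.exists_linearEquiv_restrict_eq
    ((LinearEquiv.toSpanNonzeroSingleton (ZMod 2) (Idx m) _ h0).symm ≪≫ₗ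
      LinearEquiv.toSpanNonzeroSingleton (ZMod 2) (Idx m) a ha)
  obtain ⟨g, hg⟩ := exists_gl_vecMul_eq e
  refine ⟨g, ?_⟩
  have h := he (LinearEquiv.toSpanNonzeroSingleton (ZMod 2) (Idx m) _ h0 1)
  rw [LinearEquiv.trans_apply, LinearEquiv.symm_apply_apply] at h
  simpa [hg] using h.symm

/-- Modulo `C` the two row maps have the same range, so they differ by an automorphism of the
source. With `C` spanned by the all-one word this classifies affine orbits; with general `C` it
gives transitivity modulo `C(m)`. -/
theorem exists_affineAct_sub_mem {C : BinaryCode N₁ N₂} {M M' : Word m N₁ N₂}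
    (h : C ⊔ LinearMap.range (rowMap M) = C ⊔ LinearMap.range (rowMap M')) :
    ∃ g : GL (Fin m) (ZMod 2), M' - affineAct g 0 M ∈ extendCode m C := by
  have hr : ∀ M : Word m N₁ N₂, LinearMap.range (C.mkQ ∘ₗ rowMap M) =
      (C ⊔ LinearMap.range (rowMap M)).map C.mkQ := by
    intro M
    rw [LinearMap.range_comp, Submodule.map_sup, Submodule.mkQ_map_self, bot_sup_eq]
  obtain ⟨e, he⟩ := exists_linearEquiv_comp_eq_of_range_eq (C.mkQ ∘ₗ rowMap M)
    (C.mkQ ∘ₗ rowMap M') (by rw [hr, hr, h])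
  obtain ⟨g, hg⟩ := exists_gl_vecMul_eq e
  refine ⟨g, mem_extendCode_iff_range_le.2 ?_⟩
  rintro _ ⟨a, rfl⟩
  rw [rowMap_sub, rowMap_affineAct, hg, dotProduct_zero, zero_smul, add_zero]
  exact (Submodule.Quotient.eq C).1 (he a).symm

theorem exists_affineAct_eq {M M' : Word m N₁ N₂} (h : wordCode M = wordCode M') :
    ∃ (g : GL (Fin m) (ZMod 2)) (v : Idx m), affineAct g v M = M' := by
  obtain ⟨g, hg⟩ := exists_affineAct_sub_mem (C := Submodule.span (ZMod 2) {1}) (M := M) (M' := M')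
    (by simpa only [wordCode, sup_comm] using h)
  -- Each row of the difference is a multiple of the all-one word; the multiples are the coordinates
  -- of the translation vector.
  choose v hv using fun k => Submodule.mem_span_singleton.1 (hg k)
  refine ⟨g, v, ?_⟩
  funext p k
  have := congrFun (hv k) p
  simp only [affineAct, Pi.smul_apply, Pi.one_apply, smul_eq_mul, mul_one, Pi.sub_apply,
    Pi.add_apply, add_zero] at this ⊢
  rw [this]
  ring

/-! ### Indicator tensors of codes -/

open Classical in
/-- The indicator function of the code `C(m)`. -/
noncomputable def codeInd (m : ℕ) (C : BinaryCode N₁ N₂) : Word m N₁ N₂ → ℂ :=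
  fun M => if M ∈ extendCode m C then 1 else 0

theorem toPoly_codeInd (C : BinaryCode N₁ N₂) :
    toPoly m N₁ N₂ (codeInd m C) = ccwe (extendCode m C) := by
  classical
  rw [toPoly_apply, ccwe, Finset.sum_filter]
  exact Finset.sum_congr rfl fun M _ => by simp [codeInd]

open Classical in
/-- The indicator function of the words with a given row code. -/
noncomputable def orbitInd (m : ℕ) (C : BinaryCode N₁ N₂) : Word m N₁ N₂ → ℂ :=
  fun M => if wordCode M = C then 1 else 0

instance : Finite (BinaryCode N₁ N₂) := Finite.of_injective _ SetLike.coe_injective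

/-- The doubly-even codes containing the all-one word. -/
def IsAdmissible (C : BinaryCode N₁ N₂) : Prop := IsDoublyEven C ∧ 1 ∈ C

theorem IsAdmissible.mono {C D : BinaryCode N₁ N₂} (hC : IsAdmissible C) (h1 : 1 ∈ D)
    (h : D ≤ C) : IsAdmissible D :=
  ⟨fun c hc => hC.1 c (h hc), h1⟩

/-- Möbius inversion on the poset of codes: `codeInd m C` is the sum of `orbitInd m D` over the
subcodes `D` of `C` containing the all-one word, and the proper ones are treated by induction. -/
theorem orbitInd_mem_span {C : BinaryCode N₁ N₂} (hC : IsAdmissible C) :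
    orbitInd m C ∈ Submodule.span ℂ (codeInd m '' {D | IsAdmissible D}) := by
  classical
  have := Fintype.ofFinite (BinaryCode N₁ N₂)
  induction C using WellFoundedLT.induction with
  | ind C ih =>
    have h : orbitInd m C = codeInd m C -
        ∑ D ∈ Finset.univ.filter (fun D : BinaryCode N₁ N₂ => D < C ∧ 1 ∈ D), orbitInd m D := by
      funext M
      simp only [Pi.sub_apply, Finset.sum_apply, orbitInd, codeInd, Finset.sum_ite_eq,
        Finset.mem_filter, Finset.mem_univ, true_and, one_mem_wordCode, and_true,
        ← wordCode_le_iff hC.2]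
      rcases eq_or_ne (wordCode M) C with h | h
      · simp [h]
      · simp [h, lt_iff_le_and_ne]
    rw [h]
    refine Submodule.sub_mem _ (Submodule.subset_span ⟨C, hC, rfl⟩) (Submodule.sum_mem _ ?_)
    intro D hD
    obtain ⟨hD, hD1⟩ := (Finset.mem_filter.1 hD).2
    exact ih D hD (hC.mono hD1 hD.le)

theorem mem_span_codeInd_of_invariant {F : Word m N₁ N₂ → ℂ}
    (hF : ∀ g v M, F (affineAct g v M) = F M) (hg : ∀ M, F M ≠ 0 → IsDoublyEven (wordCode M)) :
    F ∈ Submodule.span ℂ (codeInd m '' {D | IsAdmissible D}) := by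
  classical
  have := Fintype.ofFinite (BinaryCode N₁ N₂)
  have hex : ∀ C : BinaryCode N₁ N₂, ∃ a : ℂ, (∀ M, wordCode M = C → F M = a) ∧
      (a ≠ 0 → IsAdmissible C) := by
    intro C
    by_cases h : ∃ M : Word m N₁ N₂, wordCode M = C
    · obtain ⟨M, rfl⟩ := h
      refine ⟨F M, fun M' h => ?_, fun h => ⟨hg M h, one_mem_wordCode M⟩⟩
      obtain ⟨g, v, rfl⟩ := exists_affineAct_eq h
      exact (hF g v M').symm
    · exact ⟨0, fun M hM => (h ⟨M, hM⟩).elim, fun h => (h rfl).elim⟩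
  choose a ha ha' using hex
  have h : F = ∑ C, a C • orbitInd m C := by
    funext M
    simp [orbitInd, ha _ M rfl]
  rw [h]
  refine Submodule.sum_mem _ fun C _ => ?_
  by_cases h0 : a C = 0
  · simp [h0]
  · exact Submodule.smul_mem _ _ (orbitInd_mem_span (ha' C h0))

/-! ### Averaging over the affine group -/

/-- The average over the affine group. -/
noncomputable def affineAverage (m N₁ N₂ : ℕ) :
    (Word m N₁ N₂ → ℂ) →ₗ[ℂ] (Word m N₁ N₂ → ℂ) :=
  (Fintype.card (GL (Fin m) (ZMod 2) × Idx m) : ℂ)⁻¹ •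
    ∑ x : GL (Fin m) (ZMod 2) × Idx m, LinearMap.funLeft ℂ ℂ (affineAct x.1 x.2)

theorem affineAverage_apply (f : Word m N₁ N₂ → ℂ) (M : Word m N₁ N₂) :
    affineAverage m N₁ N₂ f M = (Fintype.card (GL (Fin m) (ZMod 2) × Idx m) : ℂ)⁻¹ *
      ∑ x : GL (Fin m) (ZMod 2) × Idx m, f (affineAct x.1 x.2 M) := by
  simp [affineAverage, LinearMap.funLeft_apply]

theorem affineAverage_affineAct (f : Word m N₁ N₂ → ℂ) (g : GL (Fin m) (ZMod 2)) (v : Idx m)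
    (M : Word m N₁ N₂) : affineAverage m N₁ N₂ f (affineAct g v M) = affineAverage m N₁ N₂ f M := by
  simp only [affineAverage_apply, affineAct_affineAct, Fintype.sum_prod_type]
  congr 1
  rw [← Equiv.sum_comp (Equiv.mulRight g) (fun x => ∑ w, f (affineAct x w M))]
  refine Finset.sum_congr rfl fun x _ => ?_
  exact Equiv.sum_comp (Equiv.addLeft (x.1.mulVec v)) (fun w => f (affineAct (x * g) w M))

theorem affineAverage_eq_self {f : Word m N₁ N₂ → ℂ} (hf : ∀ g v M, f (affineAct g v M) = f M) :
    affineAverage m N₁ N₂ f = f := by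
  funext M
  simp only [affineAverage_apply, hf, Finset.sum_const, Finset.card_univ, nsmul_eq_mul]
  exact inv_mul_cancel_left₀ (Nat.cast_ne_zero.2 Fintype.card_ne_zero) _

end


section

variable {m N₁ N₂ : ℕ}

/-! ### Phases -/

theorem phase_eq_sum (S : Matrix (Fin m) (Fin m) ℤ) (M : Word m N₁ N₂) :
    phase S M = ∑ k, ∑ l, S k l * overlap (fun p => M p k) (fun p => M p l) := by
  simp only [phase, overlap, Matrix.mulVec, dotProduct, lift, Finset.mul_sum]
  rw [Finset.sum_comm]
  refine Finset.sum_congr rfl fun k _ => ?_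
  rw [Finset.sum_comm]
  exact Finset.sum_congr rfl fun l _ => Finset.sum_congr rfl fun p _ => by ring

/-- Off-diagonal terms come in equal pairs, so evenness suffices for them. -/
theorem four_dvd_sum_sum {ι : Type*} (s : Finset ι) (A : ι → ι → ℤ) (hA : ∀ k l, A k l = A l k)
    (h4 : ∀ k, 4 ∣ A k k) (h2 : ∀ k l, 2 ∣ A k l) : 4 ∣ ∑ k ∈ s, ∑ l ∈ s, A k l := by
  induction s using Finset.cons_induction with
  | empty => simp
  | cons a s ha ih =>
    have h : ∑ k ∈ Finset.cons a s ha, ∑ l ∈ Finset.cons a s ha, A k l =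
        A a a + 2 * ∑ l ∈ s, A a l + ∑ k ∈ s, ∑ l ∈ s, A k l := by
      simp only [Finset.sum_cons, Finset.sum_add_distrib]
      rw [Finset.sum_congr rfl fun k _ => hA k a]
      ring
    have h2' : 2 ∣ ∑ l ∈ s, A a l := Finset.dvd_sum fun l _ => h2 a l
    have h4' := h4 a
    rw [h]
    omega

theorem four_dvd_phase {C : BinaryCode N₁ N₂} (hC : IsDoublyEven C)
    {S : Matrix (Fin m) (Fin m) ℤ} (hS : S.IsSymm) {M : Word m N₁ N₂}
    (hM : M ∈ extendCode m C) : 4 ∣ phase S M := by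
  rw [phase_eq_sum]
  refine four_dvd_sum_sum _ _ (fun k l => ?_) (fun k => ?_) (fun k l => ?_)
  · rw [hS.apply k l]
    congr 1
    exact Finset.sum_congr rfl fun p _ => by ring
  · rw [overlap_self]
    exact (hC _ (hM k)).mul_left _
  · exact (two_dvd_overlap.2 (hC.dotProduct_eq_zero (hM k) (hM l))).mul_left _

/-- This one symmetric matrix, moved around by the affine group, detects all the weights needed for
double evenness. -/
theorem phase_single [NeZero m] (M : Word m N₁ N₂) :
    phase (Matrix.single 0 0 1) M = wt (fun p => M p 0) := by
  rw [phase_eq_sum, Finset.sum_eq_single 0, Finset.sum_eq_single 0, overlap_self]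
  · simp
  · intro l _ hl
    simp [Matrix.single, hl.symm]
  · simp
  · intro k _ hk
    simp [Matrix.single, hk.symm]
  · simp

theorem I_zpow_eq_one_iff (n : ℤ) : Complex.I ^ n = 1 ↔ 4 ∣ n := by
  constructor
  · intro h
    obtain ⟨q, hq⟩ : ∃ q, n = 4 * q + n % 4 := ⟨n / 4, by omega⟩
    have h4 : Complex.I ^ (4 : ℤ) = 1 := by exact_mod_cast Complex.I_pow_four
    rw [hq, zpow_add₀ Complex.I_ne_zero, zpow_mul, h4, one_zpow, one_mul] at h
    have h0 : 0 ≤ n % 4 := Int.emod_nonneg _ (by norm_num)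
    have h5 : n % 4 < 4 := Int.emod_lt_of_pos _ (by norm_num)
    generalize hr : n % 4 = r at *
    interval_cases r
    · omega
    · simp [Complex.ext_iff] at h
    · rw [show (2 : ℤ) = ((2 : ℕ) : ℤ) by rfl, zpow_natCast, Complex.I_sq] at h
      norm_num at h
    · rw [show (3 : ℤ) = ((3 : ℕ) : ℤ) by rfl, zpow_natCast, Complex.I_pow_three] at h
      simp [Complex.ext_iff] at h
  · rintro ⟨q, rfl⟩
    rw [zpow_mul]
    have h4 : Complex.I ^ (4 : ℤ) = 1 := by exact_mod_cast Complex.I_pow_four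
    rw [h4, one_zpow]

theorem sum_I_zpow_pow (n : ℤ) :
    ∑ j ∈ Finset.range 4, (Complex.I ^ n) ^ j = if 4 ∣ n then 4 else 0 := by
  split_ifs with h
  · simp [(I_zpow_eq_one_iff n).2 h]
  · have h1 := mul_geom_sum (Complex.I ^ n) 4
    have h2 : (Complex.I ^ n) ^ 4 = 1 := by
      rw [← zpow_natCast, ← zpow_mul, I_zpow_eq_one_iff]
      exact ⟨n, by push_cast; ring⟩
    rw [h2, sub_self] at h1
    exact (mul_eq_zero.1 h1).resolve_left (sub_ne_zero.2 fun h' => h ((I_zpow_eq_one_iff n).1 h'))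

/-- A word generates a doubly-even code exactly if the first rows of its affine images have weight
divisible by `4`. -/
theorem isDoublyEven_wordCode_iff [NeZero m] {M : Word m N₁ N₂} :
    IsDoublyEven (wordCode M) ↔ ∀ x : GL (Fin m) (ZMod 2) × Idx m,
      4 ∣ phase (Matrix.single 0 0 1) (affineAct x.1 x.2 M) := by
  simp only [phase_single]
  constructor
  · intro h x
    have h' := row_mem_wordCode (affineAct x.1 x.2 M) 0
    rw [wordCode_affineAct] at h'
    exact h _ h'
  · intro h
    have h1 : ∀ a : Idx m, a ≠ 0 → ∀ b : ZMod 2, 4 ∣ wt (rowMap M a + b • 1) := by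
      intro a ha b
      obtain ⟨g, hg⟩ := exists_gl_row_eq ha
      have := h (g, Pi.single 0 b)
      rw [← rowMap_single, rowMap_affineAct, hg] at this
      simpa using this
    -- The all-one word corresponds to `a = 0`, which no first row of a `g` reaches. Its weight is
    -- obtained from `wt (r + 1) = wt 1 - wt r` for a row `r`.
    have h2 : (4 : ℤ) ∣ wt (1 : Pos N₁ N₂ → ZMod 2) := by
      have h0 : (Pi.single 0 1 : Idx m) ≠ 0 := by simp
      have h3 := h1 _ h0 0
      have h4 := h1 _ h0 1
      rw [zero_smul, add_zero] at h3
      have h5 : overlap (rowMap M (Pi.single 0 1)) 1 = wt (rowMap M (Pi.single 0 1)) := by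
        rw [wt_eq_sum]
        refine Finset.sum_congr rfl fun p _ => ?_
        simp [ZMod.val_one]
      rw [one_smul, wt_add, h5] at h4
      omega
    intro x hx
    obtain ⟨_, ⟨a, rfl⟩, _, hb, rfl⟩ := Submodule.mem_sup.1 hx
    obtain ⟨b, rfl⟩ := Submodule.mem_span_singleton.1 hb
    by_cases ha : a = 0
    · subst ha
      rw [map_zero, zero_add]
      have h01 : ∀ b : ZMod 2, b = 0 ∨ b = 1 := by decide
      rcases h01 b with rfl | rfl
      · simp [wt_zero]
      · simpa using h2
    · exact h1 a ha b

/-! ### Invariance and tensors -/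

/-- Invariance under the complex Clifford group. -/
def IsInvariant [NeZero m] (p : ConjPoly (Idx m)) : Prop :=
  ∀ U ∈ cliffordGroup m, conjAction (U : Matrix (Idx m) (Idx m) ℂ) p = p

theorem IsInvariant.diagonal [NeZero m] {p : ConjPoly (Idx m)} (hp : IsInvariant p)
    {S : Matrix (Fin m) (Fin m) ℤ} (hS : S.IsSymm) : conjAction (diagonalMatrix S) p = p :=
  hp ⟨_, diagonalMatrix_mem S⟩ (Subgroup.subset_closure (Or.inl (Or.inl ⟨S, hS, rfl⟩)))

theorem IsInvariant.affine [NeZero m] {p : ConjPoly (Idx m)} (hp : IsInvariant p)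
    (g : GL (Fin m) (ZMod 2)) (v : Idx m) : conjAction (affineMatrix g v) p = p :=
  hp ⟨_, affineMatrix_mem g v⟩ (Subgroup.subset_closure (Or.inl (Or.inr ⟨g, v, rfl⟩)))

theorem IsInvariant.hadamard [NeZero m] {p : ConjPoly (Idx m)} (hp : IsInvariant p) :
    conjAction (hadamardMatrix m) p = p :=
  hp ⟨_, hadamardMatrix_mem m⟩ (Subgroup.subset_closure (Or.inr rfl))

theorem isInvariant_of_generators [NeZero m] {p : ConjPoly (Idx m)}
    (hd : ∀ S : Matrix (Fin m) (Fin m) ℤ, S.IsSymm → conjAction (diagonalMatrix S) p = p)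
    (ha : ∀ (g : GL (Fin m) (ZMod 2)) (v : Idx m), conjAction (affineMatrix g v) p = p)
    (hh : conjAction (hadamardMatrix m) p = p) : IsInvariant p := by
  intro U hU
  induction hU using Subgroup.closure_induction with
  | mem U hU =>
    rcases hU with (⟨S, hS, rfl⟩ | ⟨g, v, rfl⟩) | rfl
    · exact hd S hS
    · exact ha g v
    · exact hh
  | one => simp [conjAction_one]
  | mul U W _ _ h1 h2 => rw [Submonoid.coe_mul, conjAction_mul, AlgHom.comp_apply, h2, h1]
  | inv U _ h =>
    have h' : conjAction ((U⁻¹ * U : Matrix.unitaryGroup (Idx m) ℂ) : Matrix (Idx m) (Idx m) ℂ) p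
        = p := by simp [conjAction_one]
    rwa [Submonoid.coe_mul, conjAction_mul, AlgHom.comp_apply, h] at h'

open Classical in
/-- The restriction of a tensor to the words that generate a doubly-even code. -/
noncomputable def evenPart (m N₁ N₂ : ℕ) : (Word m N₁ N₂ → ℂ) →ₗ[ℂ] (Word m N₁ N₂ → ℂ) where
  toFun f := fun M => if IsDoublyEven (wordCode M) then f M else 0
  map_add' f f' := by
    funext M
    by_cases h : IsDoublyEven (wordCode M) <;> simp [h]
  map_smul' a f := by
    funext M
    by_cases h : IsDoublyEven (wordCode M) <;> simp [h]

open Classical in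
theorem evenPart_apply (f : Word m N₁ N₂ → ℂ) (M : Word m N₁ N₂) :
    evenPart m N₁ N₂ f M = if IsDoublyEven (wordCode M) then f M else 0 := rfl

theorem affineAverage_evenPart_mem_span (f : Word m N₁ N₂ → ℂ) :
    affineAverage m N₁ N₂ (evenPart m N₁ N₂ f) ∈
      Submodule.span ℂ (codeInd m '' {D | IsAdmissible D}) := by
  refine mem_span_codeInd_of_invariant (affineAverage_affineAct _) fun M hM => ?_
  by_contra h
  refine hM ?_
  simp [affineAverage_apply, evenPart_apply, wordCode_affineAct, h]

variable [NeZero m]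

theorem IsInvariant.toPoly_comp_affineAct {f : Word m N₁ N₂ → ℂ}
    (hf : IsInvariant (toPoly m N₁ N₂ f)) (g : GL (Fin m) (ZMod 2)) (v : Idx m) :
    toPoly m N₁ N₂ (fun M => f (affineAct g v M)) = toPoly m N₁ N₂ f := by
  have h := conjAction_affineMatrix_toPoly g⁻¹ (-(g⁻¹).1.mulVec v) (fun M => f (affineAct g v M))
  simp only [affineAct_affineAct_inv] at h
  rw [hf.affine] at h
  exact h.symm

theorem IsInvariant.toPoly_affineAverage {f : Word m N₁ N₂ → ℂ}
    (hf : IsInvariant (toPoly m N₁ N₂ f)) :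
    toPoly m N₁ N₂ (affineAverage m N₁ N₂ f) = toPoly m N₁ N₂ f := by
  have h : ∀ x : GL (Fin m) (ZMod 2) × Idx m,
      toPoly m N₁ N₂ (LinearMap.funLeft ℂ ℂ (affineAct x.1 x.2) f) = toPoly m N₁ N₂ f :=
    fun x => hf.toPoly_comp_affineAct x.1 x.2
  rw [affineAverage, LinearMap.smul_apply, LinearMap.sum_apply, map_smul, map_sum,
    Finset.sum_congr rfl fun x _ => h x, Finset.sum_const, Finset.card_univ, ← Nat.cast_smul_eq_nsmul ℂ]
  exact inv_smul_smul₀ (Nat.cast_ne_zero.2 Fintype.card_ne_zero) _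

/-- The restriction is the average of the powers `0, …, 3` of `d_S` on tensors, by the root-of-unity
filter `sum_I_zpow_pow`, and each power leaves the polynomial unchanged. -/
theorem IsInvariant.toPoly_restrict_phase {f : Word m N₁ N₂ → ℂ}
    (hf : IsInvariant (toPoly m N₁ N₂ f)) {S : Matrix (Fin m) (Fin m) ℤ} (hS : S.IsSymm) :
    toPoly m N₁ N₂ (fun M => if 4 ∣ phase S M then f M else 0) = toPoly m N₁ N₂ f := by
  have h : ∀ j : ℕ, toPoly m N₁ N₂ (fun M => (Complex.I ^ phase S M) ^ j * f M) =
      toPoly m N₁ N₂ f := by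
    intro j
    induction j with
    | zero => simp
    | succ j ih =>
      have h1 := conjAction_diagonalMatrix_toPoly S
        (fun M : Word m N₁ N₂ => (Complex.I ^ phase S M) ^ j * f M)
      rw [ih, hf.diagonal hS] at h1
      rw [h1]
      congr 1
      funext M
      ring
  have h2 : (fun M : Word m N₁ N₂ => if 4 ∣ phase S M then f M else 0) =
      (4 : ℂ)⁻¹ • ∑ j ∈ Finset.range 4, fun M => (Complex.I ^ phase S M) ^ j * f M := by
    funext M
    rw [Pi.smul_apply, Finset.sum_apply, ← Finset.sum_mul, sum_I_zpow_pow]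
    split_ifs <;> simp
  rw [h2, map_smul, map_sum, Finset.sum_congr rfl fun j _ => h j]
  simp only [Finset.sum_const, Finset.card_range]
  rw [← Nat.cast_smul_eq_nsmul ℂ, smul_smul]
  norm_num

theorem IsInvariant.toPoly_restrict_affine {f : Word m N₁ N₂ → ℂ}
    (hf : IsInvariant (toPoly m N₁ N₂ f)) {S : Matrix (Fin m) (Fin m) ℤ} (hS : S.IsSymm)
    (g : GL (Fin m) (ZMod 2)) (v : Idx m) :
    toPoly m N₁ N₂ (fun M => if 4 ∣ phase S (affineAct g v M) then f M else 0) =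
      toPoly m N₁ N₂ f := by
  -- The tensor is moved by the inverse affine map, restricted, and moved back; each step changes
  -- the tensor but not its polynomial.
  have h1 := hf.toPoly_comp_affineAct g⁻¹ (-(g⁻¹).1.mulVec v)
  have h2 := (h1.symm ▸ hf).toPoly_restrict_phase hS
  have h3 := (h2.trans h1 ▸ hf).toPoly_comp_affineAct g v
  simp only [affineAct_inv_affineAct] at h3
  rw [h3, h2, h1]

/-- Restrictions for all elements of the affine group are imposed one after another; jointly they
are the condition of `isDoublyEven_wordCode_iff`. -/
theorem IsInvariant.toPoly_evenPart {f : Word m N₁ N₂ → ℂ}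
    (hf : IsInvariant (toPoly m N₁ N₂ f)) :
    toPoly m N₁ N₂ (evenPart m N₁ N₂ f) = toPoly m N₁ N₂ f := by
  classical
  have hS : (Matrix.single 0 0 1 : Matrix (Fin m) (Fin m) ℤ).IsSymm := by
    rw [Matrix.IsSymm, Matrix.transpose_single]
  have h : ∀ A : Finset (GL (Fin m) (ZMod 2) × Idx m),
      toPoly m N₁ N₂ (fun M => if ∀ x ∈ A,
        4 ∣ phase (Matrix.single 0 0 1) (affineAct x.1 x.2 M) then f M else 0) =
        toPoly m N₁ N₂ f := by
    intro A
    induction A using Finset.cons_induction with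
    | empty => simp
    | cons x A hx ih =>
      have h1 := (ih.symm ▸ hf).toPoly_restrict_affine hS x.1 x.2
      rw [ih] at h1
      simpa only [Finset.forall_mem_cons, ite_and] using h1
  have h1 := h Finset.univ
  simp only [Finset.mem_univ, true_implies, ← isDoublyEven_wordCode_iff] at h1
  exact h1

/-- The Hadamard matrix followed by the projection to the invariants of the diagonal and affine
matrices. -/
noncomputable def projectedHadamard (m N₁ N₂ : ℕ) [NeZero m] :
    (Word m N₁ N₂ → ℂ) →ₗ[ℂ] (Word m N₁ N₂ → ℂ) :=
  affineAverage m N₁ N₂ ∘ₗ evenPart m N₁ N₂ ∘ₗ hadamardAct m N₁ N₂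

theorem IsInvariant.toPoly_projectedHadamard {f : Word m N₁ N₂ → ℂ}
    (hf : IsInvariant (toPoly m N₁ N₂ f)) :
    toPoly m N₁ N₂ (projectedHadamard m N₁ N₂ f) = toPoly m N₁ N₂ f := by
  have h1 : toPoly m N₁ N₂ (hadamardAct m N₁ N₂ f) = toPoly m N₁ N₂ f := by
    rw [← conjAction_hadamardMatrix_toPoly, hf.hadamard]
  have h2 := (h1.symm ▸ hf).toPoly_evenPart
  rw [h1] at h2
  have h3 := (h2.symm ▸ hf).toPoly_affineAverage
  rw [h2] at h3
  exact h3

end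


section

variable {m N₁ N₂ : ℕ}

/-! ### Character sums over codes -/

/-- The nontrivial character of `𝔽₂`. -/
noncomputable def signChar : AddChar (ZMod 2) ℂ where
  toFun a := if a = 1 then -1 else 1
  map_zero_eq_one' := by simp
  map_add_eq_mul' a b := by
    have h : ∀ a : ZMod 2, a = 0 ∨ a = 1 := by decide
    rcases h a with rfl | rfl <;> rcases h b with rfl | rfl <;> simp [CharTwo.add_self_eq_zero]

theorem signChar_apply (a : ZMod 2) : signChar a = if a = 1 then -1 else 1 := rfl

theorem signChar_sum {ι : Type*} (s : Finset ι) (a : ι → ZMod 2) :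
    signChar (∑ i ∈ s, a i) = ∏ i ∈ s, signChar (a i) := by
  induction s using Finset.cons_induction with
  | empty => simp
  | cons i s hi ih => rw [Finset.sum_cons, Finset.prod_cons, AddChar.map_add_eq_mul, ih]

open Classical in
theorem sum_signChar_dotProduct (C : BinaryCode N₁ N₂) (y : Pos N₁ N₂ → ZMod 2) :
    ∑ x : Pos N₁ N₂ → ZMod 2, (if x ∈ C then signChar (x ⬝ᵥ y) else 0) =
      if y ∈ dualCode C then (Nat.card C : ℂ) else 0 := by
  split_ifs with h
  · rw [mem_dualCode] at h
    have h1 : ∀ x : Pos N₁ N₂ → ZMod 2, (if x ∈ C then signChar (x ⬝ᵥ y) else 0) =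
        if x ∈ C then 1 else 0 := by
      intro x
      split_ifs with hx
      · rw [h x hx, AddChar.map_zero_eq_one]
      · rfl
    simp only [h1, Finset.sum_boole]
    rw [Nat.card_eq_fintype_card, Fintype.card_subtype]
  · rw [mem_dualCode] at h
    push Not at h
    obtain ⟨z, hz, hzy⟩ := h
    have h1 : z ⬝ᵥ y = 1 := by
      have h01 : ∀ a : ZMod 2, a ≠ 0 → a = 1 := by decide
      exact h01 _ hzy
    -- Translation by `z` permutes `C` and negates every term, so the sum equals its own negative.
    have h2 := Equiv.sum_comp (Equiv.addRight z)
      (fun x : Pos N₁ N₂ → ZMod 2 => if x ∈ C then signChar (x ⬝ᵥ y) else 0)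
    simp only [Equiv.coe_addRight, C.add_mem_iff_left hz, add_dotProduct, AddChar.map_add_eq_mul,
      h1] at h2
    simp only [signChar_apply 1, if_true, mul_neg_one] at h2
    have h3 : ∀ x : Pos N₁ N₂ → ZMod 2, (if x ∈ C then -signChar (x ⬝ᵥ y) else 0) =
        -(if x ∈ C then signChar (x ⬝ᵥ y) else 0) := by
      intro x
      split_ifs <;> simp
    simp only [h3, Finset.sum_neg_distrib] at h2
    exact self_eq_neg.1 h2.symm

theorem affineAverage_codeInd {C : BinaryCode N₁ N₂} (h1 : 1 ∈ C) :
    affineAverage m N₁ N₂ (codeInd m C) = codeInd m C :=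
  affineAverage_eq_self fun g v M => by
    classical simp only [codeInd, affineAct_mem_iff h1]

/-! ### The Hadamard transform of a code -/

variable [NeZero m]

theorem hadamardMatrix_apply (w v : Idx m) :
    hadamardMatrix m w v =
      if ∀ k ≠ 0, w k = v k then (1 / (Real.sqrt 2 : ℂ)) * signChar (v 0 * w 0) else 0 := by
  have h1 : ∀ a b : ZMod 2, hadamard a b = (1 / (Real.sqrt 2 : ℂ)) * signChar (b * a) := by
    intro a b
    have h : (a = 1 ∧ b = 1) ↔ b * a = 1 := by revert a b; decide
    simp only [hadamard, Matrix.of_apply, signChar_apply, h]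
  rw [hadamardMatrix, Matrix.of_apply, ← Finset.mul_prod_erase _ _ (Finset.mem_univ 0), if_pos rfl,
    h1]
  have h2 : ∏ k ∈ Finset.univ.erase (0 : Fin m),
      (if k = 0 then hadamard else (1 : Matrix (ZMod 2) (ZMod 2) ℂ)) (w k) (v k) =
      ∏ k ∈ Finset.univ.erase (0 : Fin m), if w k = v k then (1 : ℂ) else 0 := by
    refine Finset.prod_congr rfl fun k hk => ?_
    rw [if_neg (Finset.ne_of_mem_erase hk), Matrix.one_apply]
  rw [h2, Finset.prod_ite_zero]
  simp

theorem entry_hadamardMatrix (p : Pos N₁ N₂) : entry (hadamardMatrix m) p = hadamardMatrix m := by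
  cases p with
  | inl i => rfl
  | inr j =>
    ext w v
    simp only [entry, Sum.elim_inr, Matrix.map_apply, hadamardMatrix_apply, signChar_apply]
    split_ifs <;> simp

/-- The word with its first row replaced. -/
def setRow (w : Word m N₁ N₂) (x : Pos N₁ N₂ → ZMod 2) : Word m N₁ N₂ :=
  fun p => Function.update (w p) 0 (x p)

theorem setRow_zero (w : Word m N₁ N₂) (x : Pos N₁ N₂ → ZMod 2) (p : Pos N₁ N₂) :
    setRow w x p 0 = x p := by simp [setRow]

theorem setRow_ne (w : Word m N₁ N₂) (x : Pos N₁ N₂ → ZMod 2) (p : Pos N₁ N₂) {k : Fin m}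
    (hk : k ≠ 0) : setRow w x p k = w p k := by simp [setRow, hk]

theorem setRow_mem {C : BinaryCode N₁ N₂} {w : Word m N₁ N₂} {x : Pos N₁ N₂ → ZMod 2} :
    setRow w x ∈ extendCode m C ↔ x ∈ C ∧ ∀ k ≠ 0, (fun p => w p k) ∈ C := by
  constructor
  · intro h
    refine ⟨?_, fun k hk => ?_⟩
    · simpa only [setRow_zero] using h 0
    · simpa only [setRow_ne w x _ hk] using h k
  · rintro ⟨h0, h⟩ k
    rcases eq_or_ne k 0 with rfl | hk
    · simpa only [setRow_zero] using h0
    · simpa only [setRow_ne w x _ hk] using h k hk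

theorem mem_extendCode_iff_row {C : BinaryCode N₁ N₂} {w : Word m N₁ N₂} :
    w ∈ extendCode m C ↔ (fun p => w p 0) ∈ C ∧ ∀ k ≠ 0, (fun p => w p k) ∈ C := by
  rw [← setRow_mem]
  have : setRow w (fun p => w p 0) = w := by
    funext p
    simp [setRow]
  rw [this]

/-- The matrix acts on the first tensor factor only and is real, so its effect is a normalized
Fourier transform in the first row, with the other rows fixed and no difference between the two
blocks of positions. -/
theorem hadamardAct_apply (f : Word m N₁ N₂ → ℂ) (w : Word m N₁ N₂) :
    hadamardAct m N₁ N₂ f w = (1 / (Real.sqrt 2 : ℂ)) ^ (N₁ + N₂) *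
      ∑ x : Pos N₁ N₂ → ZMod 2, signChar (x ⬝ᵥ fun p => w p 0) * f (setRow w x) := by
  classical
  have h1 : ∀ c : Word m N₁ N₂, ∏ p, hadamardMatrix m (w p) (c p) =
      if ∀ p, ∀ k ≠ 0, w p k = c p k then
        (1 / (Real.sqrt 2 : ℂ)) ^ (N₁ + N₂) * signChar ((fun p => c p 0) ⬝ᵥ fun p => w p 0)
      else 0 := by
    intro c
    simp only [hadamardMatrix_apply, Finset.prod_ite_zero, Finset.prod_mul_distrib, dotProduct,
      signChar_sum, Finset.mem_univ, true_implies, Finset.prod_const, Finset.card_univ,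
      Fintype.card_sum, Fintype.card_fin]
  simp only [hadamardAct, Matrix.mulVecLin_apply, Matrix.mulVec, dotProduct, Matrix.of_apply,
    entry_hadamardMatrix]
  simp only [h1, ite_mul, zero_mul]
  rw [← Finset.sum_filter, Finset.mul_sum]
  symm
  refine Finset.sum_nbij' (fun x => setRow w x) (fun c p => c p 0) ?_ ?_ ?_ ?_ ?_
  · intro x _
    refine Finset.mem_filter.2 ⟨Finset.mem_univ _, fun p k hk => ?_⟩
    rw [setRow_ne w x p hk]
  · simp
  · intro x _
    funext p
    exact setRow_zero w x p
  · intro c hc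
    have hc := (Finset.mem_filter.1 hc).2
    funext p k
    rcases eq_or_ne k 0 with rfl | hk
    · rw [setRow_zero]
    · rw [setRow_ne _ _ _ hk, hc p k hk]
  · intro x _
    simp only [setRow_zero, dotProduct]
    ring

open Classical in
theorem hadamardAct_codeInd (C : BinaryCode N₁ N₂) (w : Word m N₁ N₂) :
    hadamardAct m N₁ N₂ (codeInd m C) w =
      if (fun p => w p 0) ∈ dualCode C ∧ ∀ k ≠ 0, (fun p => w p k) ∈ C then
        (sizeRatio C : ℂ) else 0 := by
  rw [hadamardAct_apply]
  simp only [codeInd, setRow_mem, mul_ite, mul_one, mul_zero]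
  by_cases h : ∀ k ≠ 0, (fun p => w p k) ∈ C
  · simp only [eq_true h, and_true, sum_signChar_dotProduct, sizeRatio]
    split_ifs <;> simp
  · simp [h]

/-! ### The projected Hadamard transform of a code -/

theorem mem_sup_span_iff {C : BinaryCode N₁ N₂} {r x : Pos N₁ N₂ → ZMod 2} :
    x ∈ C ⊔ Submodule.span (ZMod 2) {r} ↔ x ∈ C ∨ x - r ∈ C := by
  constructor
  · intro hx
    obtain ⟨c, hc, _, hb, rfl⟩ := Submodule.mem_sup.1 hx
    obtain ⟨b, rfl⟩ := Submodule.mem_span_singleton.1 hb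
    have h01 : ∀ b : ZMod 2, b = 0 ∨ b = 1 := by decide
    rcases h01 b with rfl | rfl
    · left; simpa using hc
    · right; simpa using hc
  · rintro (h | h)
    · exact Submodule.mem_sup_left h
    · exact Submodule.mem_sup.2 ⟨_, h, r, Submodule.mem_span_singleton_self r, by simp⟩

theorem sup_span_eq_of_mem {C : BinaryCode N₁ N₂} {r x : Pos N₁ N₂ → ZMod 2}
    (hx : x ∈ C ⊔ Submodule.span (ZMod 2) {r}) (hxC : x ∉ C) :
    C ⊔ Submodule.span (ZMod 2) {x} = C ⊔ Submodule.span (ZMod 2) {r} := by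
  have h := (mem_sup_span_iff.1 hx).resolve_left hxC
  apply le_antisymm
  · exact sup_le le_sup_left ((Submodule.span_singleton_le_iff_mem _ _).2 hx)
  · refine sup_le le_sup_left ((Submodule.span_singleton_le_iff_mem _ _).2 ?_)
    rw [mem_sup_span_iff]
    right
    rw [← neg_sub]
    exact C.neg_mem h

/-- Adjoining a vector of the dual with weight divisible by `4` to an admissible code gives an
admissible code. -/
theorem IsAdmissible.sup_span {C : BinaryCode N₁ N₂} (hC : IsAdmissible C)
    {r : Pos N₁ N₂ → ZMod 2} (hr : r ∈ dualCode C) (h4 : 4 ∣ wt r) :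
    IsAdmissible (C ⊔ Submodule.span (ZMod 2) {r}) := by
  refine ⟨fun x hx => ?_, Submodule.mem_sup_left hC.2⟩
  rcases mem_sup_span_iff.1 hx with h | h
  · exact hC.1 x h
  · have h1 := hC.1 _ h
    have h2 := two_dvd_overlap.2 (mem_dualCode.1 hr _ h)
    have h3 := wt_add (x - r) r
    rw [sub_add_cancel] at h3
    omega

/-- The admissible codes that contain `C` with index `2`. -/
def IsExtension (C D : BinaryCode N₁ N₂) : Prop :=
  IsAdmissible D ∧ ∃ r ∉ C, D = C ⊔ Submodule.span (ZMod 2) {r}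

theorem IsExtension.lt {C D : BinaryCode N₁ N₂} (h : IsExtension C D) : C < D := by
  obtain ⟨_, r, hr, rfl⟩ := h
  refine lt_of_le_of_ne le_sup_left fun he => hr ?_
  rw [he]
  exact Submodule.mem_sup_right (Submodule.mem_span_singleton_self r)

open Classical in
/-- The indicator function of the words of `D(m)` of which exactly the first row is not in `C`. -/
noncomputable def firstRowInd (m : ℕ) [NeZero m] (C D : BinaryCode N₁ N₂) : Word m N₁ N₂ → ℂ :=
  fun M => if M ∈ extendCode m D ∧ (fun p => M p 0) ∉ C ∧ ∀ k ≠ 0, (fun p => M p k) ∈ C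
    then 1 else 0

-- After the Hadamard transform the first row `r` ranges over the dual of `C` and the other rows
-- over `C`. If `r ∉ C`, such a word generates a doubly-even code exactly when `C` with `r` adjoined
-- is admissible.
open Classical in
theorem evenPart_hadamardAct_codeInd [Fintype (BinaryCode N₁ N₂)] {C : BinaryCode N₁ N₂}
    (hC : IsAdmissible C) :
    evenPart m N₁ N₂ (hadamardAct m N₁ N₂ (codeInd m C)) =
      (sizeRatio C : ℂ) • (codeInd m C +
        ∑ D ∈ Finset.univ.filter (IsExtension C), firstRowInd m C D) := by
  funext M
  rw [evenPart_apply, hadamardAct_codeInd]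
  simp only [Pi.smul_apply, Pi.add_apply, Finset.sum_apply, codeInd, firstRowInd, smul_eq_mul,
    mem_extendCode_iff_row (C := C)]
  by_cases hk : ∀ k ≠ 0, (fun p => M p k) ∈ C
  swap
  · simp [hk]
  by_cases h0 : (fun p => M p 0) ∈ C
  · have hM : IsDoublyEven (wordCode M) := fun x hx =>
      hC.1 x ((wordCode_le_iff hC.2).2 (mem_extendCode_iff_row.2 ⟨h0, hk⟩) hx)
    rw [if_pos hM, if_pos ⟨hC.1.le_dualCode h0, hk⟩, if_pos ⟨h0, hk⟩]
    simp [h0]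
  · set r : Pos N₁ N₂ → ZMod 2 := fun p => M p 0 with hr
    have hmem : ∀ D, C ≤ D → (M ∈ extendCode m D ↔ r ∈ D) := by
      intro D hD
      rw [mem_extendCode_iff_row]
      exact and_iff_left fun k hk' => hD (hk k hk')
    -- An extension of index `2` that contains `r ∉ C` must be `C` with `r` adjoined, so one term of
    -- the sum survives.
    have hsum : ∀ D ∈ Finset.univ.filter (IsExtension C),
        (if M ∈ extendCode m D ∧ r ∉ C ∧ ∀ k ≠ 0, (fun p => M p k) ∈ C then (1 : ℂ) else 0) =
        if D = C ⊔ Submodule.span (ZMod 2) {r} then 1 else 0 := by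
      intro D hD
      have hD := (Finset.mem_filter.1 hD).2
      rw [hmem D hD.lt.le]
      refine if_congr ⟨?_, ?_⟩ rfl rfl
      · rintro ⟨h1, -⟩
        obtain ⟨_, s, hs, rfl⟩ := hD
        exact (sup_span_eq_of_mem h1 h0).symm
      · rintro rfl
        exact ⟨Submodule.mem_sup_right (Submodule.mem_span_singleton_self r), h0, hk⟩
    rw [Finset.sum_congr rfl hsum, Finset.sum_ite_eq',
      if_neg (show ¬(r ∈ C ∧ ∀ k ≠ 0, (fun p => M p k) ∈ C) from fun h => h0 h.1), zero_add,
      ← ite_and, mul_ite, mul_one, mul_zero]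
    refine if_congr ?_ rfl rfl
    rw [Finset.mem_filter]
    constructor
    · rintro ⟨h1, h2, -⟩
      exact ⟨Finset.mem_univ _, hC.sup_span h2 (h1 _ (row_mem_wordCode M 0)), r, h0, rfl⟩
    · rintro ⟨-, hD, -⟩
      refine ⟨fun x hx => hD.1 x ((wordCode_le_iff hD.2).2 ((hmem _ le_sup_left).2 ?_) hx), ?_, hk⟩
      · exact Submodule.mem_sup_right (Submodule.mem_span_singleton_self r)
      · rw [mem_dualCode]
        exact fun c hc => hD.1.dotProduct_eq_zero (Submodule.mem_sup_left hc)
          (Submodule.mem_sup_right (Submodule.mem_span_singleton_self r))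

theorem firstRowInd_sub_mem {C D : BinaryCode N₁ N₂} (hCD : C ≤ D) {M M' : Word m N₁ N₂}
    (h : M' - M ∈ extendCode m C) : firstRowInd m C D M' = firstRowInd m C D M := by
  classical
  have h1 : ∀ E : BinaryCode N₁ N₂, C ≤ E → ∀ k,
      ((fun p => M' p k) ∈ E ↔ (fun p => M p k) ∈ E) := by
    intro E hE k
    have h2 : (fun p => M' p k) = (fun p => (M' - M) p k) + fun p => M p k := by
      funext p
      simp
    rw [h2]
    exact E.add_mem_iff_right (hE (h k))
  simp only [firstRowInd, mem_extendCode, h1 C le_rfl, h1 D hCD]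

/-- The affine average of the indicator function of the words of `D(m)` of which exactly the first
row is not in `C` is a nonnegative multiple of that of `D(m) \ C(m)`. -/
theorem exists_affineAverage_firstRowInd {C D : BinaryCode N₁ N₂} (h1 : 1 ∈ C)
    (hD : ∃ r ∉ C, D = C ⊔ Submodule.span (ZMod 2) {r}) :
    ∃ κ : ℝ, 0 ≤ κ ∧ affineAverage m N₁ N₂ (firstRowInd m C D) =
      (κ : ℂ) • (codeInd m D - codeInd m C) := by
  classical
  have hCD : C ≤ D := by
    obtain ⟨r, _, rfl⟩ := hD
    exact le_sup_left
  have hreal : ∀ M, ∃ κ : ℝ, 0 ≤ κ ∧ affineAverage m N₁ N₂ (firstRowInd m C D) M = κ := by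
    intro M
    refine ⟨(Fintype.card (GL (Fin m) (ZMod 2) × Idx m) : ℝ)⁻¹ *
      ∑ x : GL (Fin m) (ZMod 2) × Idx m, if affineAct x.1 x.2 M ∈ extendCode m D ∧
        (fun p => affineAct x.1 x.2 M p 0) ∉ C ∧
          ∀ k ≠ 0, (fun p => affineAct x.1 x.2 M p k) ∈ C then 1 else 0, ?_, ?_⟩
    · refine mul_nonneg (by positivity) (Finset.sum_nonneg fun x _ => ?_)
      split_ifs <;> norm_num
    · rw [affineAverage_apply]
      push_cast
      congr 1
      refine Finset.sum_congr rfl fun x _ => ?_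
      rw [firstRowInd]
      split_ifs <;> simp
  have hzero : ∀ M, (M ∉ extendCode m D ∨ M ∈ extendCode m C) →
      affineAverage m N₁ N₂ (firstRowInd m C D) M = 0 := by
    intro M hM
    rw [affineAverage_apply, Finset.sum_eq_zero, mul_zero]
    intro x _
    rw [firstRowInd, if_neg]
    rintro ⟨h2, h3, -⟩
    rcases hM with h | h
    · exact h ((affineAct_mem_iff (hCD h1) _ _).1 h2)
    · exact h3 (affineAct_mem h1 x.1 x.2 h 0)
  have hsup : ∀ M : Word m N₁ N₂, M ∈ extendCode m D → M ∉ extendCode m C →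
      C ⊔ LinearMap.range (rowMap M) = D := by
    intro M hMD hMC
    obtain ⟨r, hr, rfl⟩ := hD
    rw [mem_extendCode_iff_range_le] at hMC hMD
    obtain ⟨x, hx, hxC⟩ := SetLike.not_le_iff_exists.1 hMC
    apply le_antisymm (sup_le le_sup_left hMD)
    rw [← sup_span_eq_of_mem (hMD hx) hxC]
    exact sup_le le_sup_left ((Submodule.span_singleton_le_iff_mem _ _).2
      (Submodule.mem_sup_right hx))
  -- Since `D / C` is a line, any two words of `D(m)` outside `C(m)` are related by `GL(m,2)` up to
  -- `C(m)`, and the averaged function does not see `C(m)`.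
  have hconst : ∀ M M' : Word m N₁ N₂, M ∈ extendCode m D → M ∉ extendCode m C →
      M' ∈ extendCode m D → M' ∉ extendCode m C →
      affineAverage m N₁ N₂ (firstRowInd m C D) M' =
        affineAverage m N₁ N₂ (firstRowInd m C D) M := by
    intro M M' hM1 hM2 hM1' hM2'
    obtain ⟨g, hg⟩ := exists_affineAct_sub_mem (C := C) (M := M) (M' := M')
      (by rw [hsup M hM1 hM2, hsup M' hM1' hM2'])
    rw [← affineAverage_affineAct _ g 0 M, affineAverage_apply, affineAverage_apply]
    congr 1
    refine Finset.sum_congr rfl fun x _ => firstRowInd_sub_mem hCD ?_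
    have h2 : affineAct x.1 x.2 M' - affineAct x.1 x.2 (affineAct g 0 M) =
        affineAct x.1 0 (M' - affineAct g 0 M) := by
      funext p
      simp [affineAct, Matrix.mulVec_sub]
    rw [h2]
    exact affineAct_mem h1 _ _ hg
  by_cases hex : ∃ M : Word m N₁ N₂, M ∈ extendCode m D ∧ M ∉ extendCode m C
  · obtain ⟨M, hM1, hM2⟩ := hex
    obtain ⟨κ, hκ, hκM⟩ := hreal M
    refine ⟨κ, hκ, ?_⟩
    funext M'
    simp only [Pi.smul_apply, Pi.sub_apply, codeInd, smul_eq_mul]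
    by_cases hD' : M' ∈ extendCode m D
    · by_cases hC' : M' ∈ extendCode m C
      · rw [hzero M' (Or.inr hC')]
        simp [hC', hD']
      · rw [hconst M M' hM1 hM2 hD' hC', hκM]
        simp [hC', hD']
    · have hC' : M' ∉ extendCode m C := fun h => hD' fun k => hCD (h k)
      rw [hzero M' (Or.inl hD')]
      simp [hC', hD']
  · push Not at hex
    refine ⟨0, le_rfl, ?_⟩
    funext M'
    rw [hzero M' (by by_cases h : M' ∈ extendCode m D; exacts [Or.inr (hex M' h), Or.inl h])]
    simp

/-- Triangularity of `T`. Each extension `D` contributes `κ D • (codeInd m D - codeInd m C)` with `κ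
D ≥ 0`, so the extensions can only lower the diagonal coefficient below `sizeRatio C`. No lower
bound on `a` is needed, since only `1 - a ≠ 0` is used later. -/
theorem exists_projectedHadamard_codeInd_sub_mem {C : BinaryCode N₁ N₂} (hC : IsAdmissible C) :
    ∃ a : ℝ, (¬ IsSelfDual C → a < 1) ∧
      projectedHadamard m N₁ N₂ (codeInd m C) - (a : ℂ) • codeInd m C ∈
        Submodule.span ℂ (codeInd m '' {D | IsAdmissible D ∧ C < D}) := by
  classical
  have := Fintype.ofFinite (BinaryCode N₁ N₂)
  choose! κ hκ0 hκ using fun D (hD : IsExtension C D) =>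
    exists_affineAverage_firstRowInd (m := m) hC.2 hD.2
  refine ⟨sizeRatio C * (1 - ∑ D ∈ Finset.univ.filter (IsExtension C), κ D), fun hsd => ?_, ?_⟩
  · have h1 : sizeRatio C < 1 :=
      sizeRatio_lt_one (lt_of_le_of_ne hC.1.le_dualCode hsd)
    have h2 : 0 ≤ ∑ D ∈ Finset.univ.filter (IsExtension C), κ D :=
      Finset.sum_nonneg fun D hD => hκ0 D (Finset.mem_filter.1 hD).2
    nlinarith [sizeRatio_nonneg C]
  · have h1 : projectedHadamard m N₁ N₂ (codeInd m C) = (sizeRatio C : ℂ) • (codeInd m C +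
        ∑ D ∈ Finset.univ.filter (IsExtension C), (κ D : ℂ) • (codeInd m D - codeInd m C)) := by
      rw [projectedHadamard, LinearMap.comp_apply, LinearMap.comp_apply,
        evenPart_hadamardAct_codeInd hC, map_smul, map_add, map_sum, affineAverage_codeInd hC.2,
        Finset.sum_congr rfl fun D hD => hκ D (Finset.mem_filter.1 hD).2]
    have h2 : projectedHadamard m N₁ N₂ (codeInd m C) -
        ((sizeRatio C * (1 - ∑ D ∈ Finset.univ.filter (IsExtension C), κ D) : ℝ) : ℂ) •
          codeInd m C =
        (sizeRatio C : ℂ) • ∑ D ∈ Finset.univ.filter (IsExtension C),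
          (κ D : ℂ) • codeInd m D := by
      rw [h1]
      simp only [smul_sub, Finset.sum_sub_distrib, ← Finset.sum_smul]
      push_cast
      module
    rw [h2]
    refine Submodule.smul_mem _ _ (Submodule.sum_mem _ fun D hD => Submodule.smul_mem _ _ ?_)
    have hD := (Finset.mem_filter.1 hD).2
    exact Submodule.subset_span ⟨D, ⟨hD.1, hD.lt⟩, rfl⟩

end


section

variable {m N₁ N₂ : ℕ}

/-! ### Invariants are spanned by enumerators of self-dual codes -/

/-- Here the tensor `codeInd m C` is itself fixed by each generator: phases on `C(m)` are divisible
by `4`, the all-one word lies in `C`, and the Fourier transform replaces `C` by its dual, which is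
`C`, with factor `1`. -/
theorem isInvariant_ccwe [NeZero m] {C : BinaryCode N₁ N₂} (hC : IsDoublyEven C)
    (hsd : IsSelfDual C) : IsInvariant (ccwe (extendCode m C)) := by
  classical
  have h1 := one_mem_of_selfDual hC hsd
  rw [← toPoly_codeInd]
  refine isInvariant_of_generators (fun S hS => ?_) (fun g v => ?_) ?_
  · rw [conjAction_diagonalMatrix_toPoly]
    congr 1
    funext M
    unfold codeInd
    split_ifs with hM
    · rw [(I_zpow_eq_one_iff _).2 (four_dvd_phase hC hS hM), one_mul]
    · rw [mul_zero]
  · have h := conjAction_affineMatrix_toPoly g v (codeInd (N₁ := N₁) (N₂ := N₂) m C)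
    simp only [codeInd, affineAct_mem_iff h1] at h
    exact h
  · rw [conjAction_hadamardMatrix_toPoly]
    congr 1
    funext M
    rw [hadamardAct_codeInd, sizeRatio_eq_one hsd, ← hsd]
    simp only [codeInd, mem_extendCode_iff_row (C := C), Complex.ofReal_one]

/-- Induction removes a minimal code from `S`. Upward closure keeps the larger codes produced by `T`
inside `S`, and minimality of the removed code preserves that closure. -/
theorem toPoly_mem_span_of_upperSet [NeZero m] (S : Finset (BinaryCode N₁ N₂))
    (hS : ∀ C ∈ S, IsAdmissible C ∧ ∀ D, IsAdmissible D → C ≤ D → D ∈ S)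
    {f : Word m N₁ N₂ → ℂ} (hf : f ∈ Submodule.span ℂ (codeInd m '' (S : Set (BinaryCode N₁ N₂))))
    (hinv : IsInvariant (toPoly m N₁ N₂ f)) :
    toPoly m N₁ N₂ f ∈ Submodule.span ℂ (Set.range fun C : DoublyEvenSelfDualCode N₁ N₂ =>
      ccwe (extendCode m C.1)) := by
  classical
  induction S using Finset.strongInduction generalizing f with
  | H S ih =>
    rcases S.eq_empty_or_nonempty with rfl | hne
    · rw [Finset.coe_empty, Set.image_empty, Submodule.span_empty, Submodule.mem_bot] at hf
      rw [hf, map_zero]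
      exact Submodule.zero_mem _
    obtain ⟨C, hCS, hmin⟩ : ∃ C ∈ S, ∀ D ∈ S, ¬ D < C := by
      obtain ⟨C, hC⟩ := S.exists_minimal hne
      exact ⟨C, hC.1, fun D hD hlt => hC.not_lt hD hlt⟩
    have hup : ∀ D, IsAdmissible D → C < D → D ∈ S.erase C := fun D hD hlt =>
      Finset.mem_erase.2 ⟨hlt.ne', (hS C hCS).2 D hD hlt.le⟩
    have hS' : ∀ E ∈ S.erase C, IsAdmissible E ∧ ∀ D, IsAdmissible D → E ≤ D → D ∈ S.erase C := by
      intro E hE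
      obtain ⟨hEC, hES⟩ := Finset.mem_erase.1 hE
      refine ⟨(hS E hES).1, fun D hD hED => Finset.mem_erase.2 ⟨?_, (hS E hES).2 D hD hED⟩⟩
      rintro rfl
      exact hmin E hES (lt_of_le_of_ne hED hEC)
    rw [← Finset.insert_erase hCS, Finset.coe_insert, Set.image_insert_eq,
      Submodule.mem_span_insert] at hf
    obtain ⟨a, w, hw, rfl⟩ := hf
    by_cases hsd : IsSelfDual C
    · have hC := isInvariant_ccwe (m := m) (hS C hCS).1.1 hsd
      have hw' : toPoly m N₁ N₂ w =
          toPoly m N₁ N₂ (a • codeInd m C + w) - a • ccwe (extendCode m C) := by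
        rw [map_add, map_smul, toPoly_codeInd, add_sub_cancel_left]
      have hwinv : IsInvariant (toPoly m N₁ N₂ w) := by
        intro U hU
        rw [hw', map_sub, map_smul, hinv U hU, hC U hU]
      rw [map_add, map_smul, toPoly_codeInd]
      refine Submodule.add_mem _ (Submodule.smul_mem _ _ ?_)
        (ih _ (Finset.erase_ssubset hCS) hS' hw hwinv)
      exact Submodule.subset_span ⟨⟨C, (hS C hCS).1.1, hsd⟩, rfl⟩
    · have hmono : ∀ E : BinaryCode N₁ N₂, (∀ D, IsAdmissible D → E < D → D ∈ S.erase C) →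
          Submodule.span ℂ (codeInd m '' {D | IsAdmissible D ∧ E < D}) ≤
            Submodule.span ℂ (codeInd m '' (S.erase C : Set (BinaryCode N₁ N₂))) :=
        fun E hE => Submodule.span_mono (Set.image_mono fun D hD => hE D hD.1 hD.2)
      obtain ⟨l, hl, hlC⟩ :=
        exists_projectedHadamard_codeInd_sub_mem (m := m) (hS C hCS).1
      have hlC := hmono C hup hlC
      have hTw : projectedHadamard m N₁ N₂ w ∈
          Submodule.span ℂ (codeInd m '' (S.erase C : Set (BinaryCode N₁ N₂))) := by
        have hle : Submodule.span ℂ (codeInd m '' (S.erase C : Set (BinaryCode N₁ N₂))) ≤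
            (Submodule.span ℂ (codeInd m '' (S.erase C : Set (BinaryCode N₁ N₂)))).comap
              (projectedHadamard m N₁ N₂) := by
          rw [Submodule.span_le]
          rintro _ ⟨E, hE, rfl⟩
          obtain ⟨b, _, hb⟩ := exists_projectedHadamard_codeInd_sub_mem (m := m) (hS' E hE).1
          have hb := hmono E (fun D hD hlt => (hS' E hE).2 D hD hlt.le) hb
          have := Submodule.add_mem _ hb (Submodule.smul_mem _ (b : ℂ)
            (Submodule.subset_span (Set.mem_image_of_mem (codeInd m) hE)))
          rwa [sub_add_cancel] at this
        exact hle hw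
      have hl1 : (1 - l : ℂ) ≠ 0 := by
        have := hl hsd
        rw [sub_ne_zero]
        exact_mod_cast this.ne'
      set f : Word m N₁ N₂ → ℂ := a • codeInd m C + w with hf
      -- The coefficient of `codeInd m C` cancels because `l` is its diagonal coefficient under `T`;
      -- the factor `(1 - l)⁻¹` restores the polynomial, which `T` fixes.
      have hf' : (1 - l : ℂ)⁻¹ • (projectedHadamard m N₁ N₂ f - (l : ℂ) • f) ∈
          Submodule.span ℂ (codeInd m '' (S.erase C : Set (BinaryCode N₁ N₂))) := by
        refine Submodule.smul_mem _ _ ?_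
        have h : projectedHadamard m N₁ N₂ f - (l : ℂ) • f =
            a • (projectedHadamard m N₁ N₂ (codeInd m C) - (l : ℂ) • codeInd m C) +
              (projectedHadamard m N₁ N₂ w - (l : ℂ) • w) := by
          rw [hf, map_add, map_smul]
          module
        rw [h]
        exact Submodule.add_mem _ (Submodule.smul_mem _ _ hlC)
          (Submodule.sub_mem _ hTw (Submodule.smul_mem _ _ hw))
      have heq : toPoly m N₁ N₂ ((1 - l : ℂ)⁻¹ • (projectedHadamard m N₁ N₂ f - (l : ℂ) • f)) =
          toPoly m N₁ N₂ f := by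
        rw [map_smul, map_sub, map_smul, hinv.toPoly_projectedHadamard, inv_smul_eq_iff₀ hl1,
          sub_smul, one_smul]
      rw [← heq] at hinv ⊢
      exact ih _ (Finset.erase_ssubset hCS) hS' hf' hinv

theorem span_ccwe_eq_cliffordInvariants (m : ℕ) [NeZero m] (N₁ N₂ : ℕ) :
    Submodule.span ℂ (Set.range fun C : DoublyEvenSelfDualCode N₁ N₂ =>
      ccwe (extendCode m C.1)) = cliffordInvariants m N₁ N₂ := by
  classical
  have := Fintype.ofFinite (BinaryCode N₁ N₂)
  apply le_antisymm
  · rw [Submodule.span_le]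
    rintro _ ⟨C, rfl⟩
    refine ⟨?_, isInvariant_ccwe C.2.1 C.2.2⟩
    dsimp only
    rw [← toPoly_codeInd]
    exact isWeightedHomogeneous_toPoly _
  · rintro p ⟨hp, hinv⟩
    obtain ⟨f, rfl⟩ := exists_toPoly_eq hp
    have hinv : IsInvariant (toPoly m N₁ N₂ f) := hinv
    have h1 := hinv.toPoly_evenPart
    have h2 := (h1.symm ▸ hinv).toPoly_affineAverage
    rw [h1] at h2
    rw [← h2] at hinv ⊢
    -- The induction starts from the set of all admissible codes.
    refine toPoly_mem_span_of_upperSet (Finset.univ.filter IsAdmissible) ?_ ?_ hinv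
    · intro C hC
      exact ⟨(Finset.mem_filter.1 hC).2, fun D hD _ =>
        Finset.mem_filter.2 ⟨Finset.mem_univ _, hD⟩⟩
    · have := affineAverage_evenPart_mem_span f
      simpa using this

/-! ### Equivalent codes and linear independence -/

theorem ccwe_eq_of_equivalent {C D : BinaryCode N₁ N₂} (h : Equivalent C D) :
    ccwe (extendCode m C) = ccwe (extendCode m D) := by
  classical
  obtain ⟨σ, τ, h⟩ := h
  rw [← toPoly_codeInd, ← toPoly_codeInd, toPoly_apply, toPoly_apply]
  rw [← Equiv.sum_comp (Equiv.arrowCongr (Equiv.sumCongr σ τ).symm (Equiv.refl (Idx m)))]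
  refine Finset.sum_congr rfl fun M _ => ?_
  have h1 : Equiv.arrowCongr (Equiv.sumCongr σ τ).symm (Equiv.refl (Idx m)) M =
      fun p => M (Sum.map σ τ p) := rfl
  have h2 : conjMonomial (fun p => M (Sum.map σ τ p)) = conjMonomial M := by
    simp only [conjMonomial, Sum.map_inl, Sum.map_inr]
    rw [Equiv.prod_comp σ (fun i => MvPolynomial.X (R := ℂ) (Sum.inl (M (Sum.inl i)) : Idx m ⊕ Idx m)),
      Equiv.prod_comp τ (fun i => MvPolynomial.X (R := ℂ) (Sum.inr (M (Sum.inr i)) : Idx m ⊕ Idx m))]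
  have h3 : (M ∈ extendCode m D) ↔ (fun p => M (Sum.map σ τ p)) ∈ extendCode m C :=
    forall_congr' fun k => h _
  rw [h1, h2]
  simp only [codeInd, h3]

/-- The exponent of the conjugate monomial of a word. -/
noncomputable def exponent (M : Word m N₁ N₂) : Idx m ⊕ Idx m →₀ ℕ :=
  ∑ p, Finsupp.single (letterIndex p (M p)) 1

theorem conjMonomial_eq_monomial (M : Word m N₁ N₂) :
    conjMonomial M = MvPolynomial.monomial (exponent M) 1 := by
  rw [conjMonomial_eq_prod, exponent, MvPolynomial.monomial_sum_one]
  rfl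

theorem exists_perm_of_card_fiber_eq {α V : Type*} [Fintype α] [DecidableEq V] (c c' : α → V)
    (h : ∀ v, Fintype.card {i // c i = v} = Fintype.card {i // c' i = v}) :
    ∃ σ : Equiv.Perm α, ∀ i, c' (σ i) = c i := by
  let e : ∀ v, {i // c i = v} ≃ {i // c' i = v} := fun v => Fintype.equivOfCardEq (h v)
  refine ⟨(Equiv.sigmaFiberEquiv c).symm.trans
    ((Equiv.sigmaCongrRight e).trans (Equiv.sigmaFiberEquiv c')), fun i => ?_⟩
  exact (e (c i) ⟨i, rfl⟩).2

/-- The exponent counts each letter separately in the two blocks of positions, so equal exponents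
give bijections of letter fibres within each block. -/
theorem exists_perm_of_exponent_eq {M M' : Word m N₁ N₂} (h : exponent M = exponent M') :
    ∃ (σ : Equiv.Perm (Fin N₁)) (τ : Equiv.Perm (Fin N₂)), ∀ p, M' (Sum.map σ τ p) = M p := by
  have hl : ∀ (M : Word m N₁ N₂) (v : Idx m),
      exponent M (Sum.inl v) = Fintype.card {i // M (Sum.inl i) = v} := by
    intro M v
    simp [exponent, Finsupp.single_apply, letterIndex,
      Fintype.sum_sum_type, Fintype.card_subtype]
  have hr : ∀ (M : Word m N₁ N₂) (v : Idx m),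
      exponent M (Sum.inr v) = Fintype.card {i // M (Sum.inr i) = v} := by
    intro M v
    simp [exponent, Finsupp.single_apply, letterIndex,
      Fintype.sum_sum_type, Fintype.card_subtype]
  obtain ⟨σ, hσ⟩ := exists_perm_of_card_fiber_eq (fun i => M (Sum.inl i)) (fun i => M' (Sum.inl i))
    fun v => by rw [← hl, ← hl, h]
  obtain ⟨τ, hτ⟩ := exists_perm_of_card_fiber_eq (fun i => M (Sum.inr i)) (fun i => M' (Sum.inr i))
    fun v => by rw [← hr, ← hr, h]
  refine ⟨σ, τ, fun p => ?_⟩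
  cases p with
  | inl i => exact hσ i
  | inr j => exact hτ j

open Classical in
theorem coeff_ccwe (C : BinaryCode N₁ N₂) (s : Idx m ⊕ Idx m →₀ ℕ) :
    MvPolynomial.coeff s (ccwe (extendCode m C)) =
      (Finset.univ.filter fun M : Word m N₁ N₂ => M ∈ extendCode m C ∧ exponent M = s).card := by
  rw [ccwe, MvPolynomial.coeff_sum]
  simp only [conjMonomial_eq_monomial, MvPolynomial.coeff_monomial]
  rw [Finset.sum_boole, Finset.filter_filter]

theorem two_mul_finrank_of_selfDual {C : BinaryCode N₁ N₂} (h : IsSelfDual C) :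
    2 * Module.finrank (ZMod 2) C = N₁ + N₂ := by
  have := finrank_add_finrank_dualCode C
  rw [← h] at this
  omega

theorem exists_wordCode_eq {C : BinaryCode N₁ N₂} (hC : IsDoublyEven C) (hsd : IsSelfDual C)
    (hm : N₁ + N₂ ≤ 2 * (m + 1)) : ∃ M : Word m N₁ N₂, wordCode M = C := by
  have h1 := one_mem_of_selfDual hC hsd
  have hd := two_mul_finrank_of_selfDual hsd
  -- The all-one word comes for free in `wordCode`, so the `m` rows need only generate a complement
  -- `K` of its span in `C`. This is where `m + 1` rather than `m` enters.
  obtain ⟨K, hK, hsup⟩ := IsModularLattice.exists_disjoint_and_sup_eq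
    ((Submodule.span_singleton_le_iff_mem _ _).2 h1)
  have hKm : Module.finrank (ZMod 2) K ≤ m := by
    have h2 := Submodule.finrank_sup_add_finrank_inf_eq
      (Submodule.span (ZMod 2) {(1 : Pos N₁ N₂ → ZMod 2)}) K
    rw [hsup, hK.eq_bot, finrank_bot, add_zero] at h2
    -- In length `0` the all-one word is zero and spans nothing; then `C` itself is zero.
    rcases Nat.eq_zero_or_pos (N₁ + N₂) with h0 | h0
    · omega
    · have h3 : (1 : Pos N₁ N₂ → ZMod 2) ≠ 0 := by
        have : Nonempty (Pos N₁ N₂) := by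
          rw [← Fintype.card_pos_iff]
          simpa using h0
        exact one_ne_zero
      rw [finrank_span_singleton h3] at h2
      omega
  -- The first `dim K` coordinates are used as coefficients of a basis of `K` and the remaining ones
  -- are dropped.
  let φ : Idx m →ₗ[ZMod 2] (Pos N₁ N₂ → ZMod 2) :=
    K.subtype ∘ₗ (Module.finBasis (ZMod 2) K).equivFun.symm.toLinearMap ∘ₗ
      LinearMap.funLeft (ZMod 2) (ZMod 2) (Fin.castLE hKm)
  have hφ : LinearMap.range φ = K := by
    rw [LinearMap.range_comp_of_range_eq_top, Submodule.range_subtype]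
    rw [LinearMap.range_comp_of_range_eq_top, LinearEquiv.range]
    exact LinearMap.range_eq_top.2
      (LinearMap.funLeft_surjective_of_injective _ _ _ (Fin.castLE_injective hKm))
  refine ⟨fun p k => φ (Pi.single k 1) p, ?_⟩
  have hrow : rowMap (fun p k => φ (Pi.single k 1) p) = φ := by
    refine LinearMap.pi_ext' fun k => LinearMap.ext_ring ?_
    exact rowMap_single _ k
  rw [wordCode, hrow, hφ, sup_comm, hsup]

/-- The column permutation carrying `M` to `M₀` sends rows in `D` to generators of `C`, so `C` lies
in the permuted `D`; self-dual codes of the same length have equal dimension. -/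
theorem equivalent_of_exponent_eq {C D : BinaryCode N₁ N₂} (hCsd : IsSelfDual C)
    (hD : IsDoublyEven D) (hDsd : IsSelfDual D) {M₀ M : Word m N₁ N₂} (hM₀ : wordCode M₀ = C)
    (hM : M ∈ extendCode m D) (h : exponent M₀ = exponent M) : Equivalent C D := by
  obtain ⟨σ, τ, hp⟩ := exists_perm_of_exponent_eq h
  let L : (Pos N₁ N₂ → ZMod 2) ≃ₗ[ZMod 2] (Pos N₁ N₂ → ZMod 2) :=
    LinearEquiv.funCongrLeft (ZMod 2) (ZMod 2) (Equiv.sumCongr σ τ)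
  have hL : ∀ c, L c = fun p => c (Sum.map σ τ p) := fun c => rfl
  have hle : C ≤ D.map L.toLinearMap := by
    rw [← hM₀, wordCode_le_iff]
    · intro k
      refine ⟨_, hM k, ?_⟩
      funext p
      exact congrFun (hp p) k
    · exact ⟨1, one_mem_of_selfDual hD hDsd, rfl⟩
  have heq : C = D.map L.toLinearMap := by
    refine Submodule.eq_of_le_of_finrank_eq hle ?_
    have h1 := two_mul_finrank_of_selfDual hCsd
    have h2 := two_mul_finrank_of_selfDual hDsd
    rw [LinearEquiv.finrank_map_eq]
    omega
  refine ⟨σ, τ, fun c => ?_⟩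
  rw [← hL, heq]
  exact ⟨fun hc => ⟨c, hc, rfl⟩, fun ⟨_, hc, h⟩ => L.injective h ▸ hc⟩

/-- The enumerator of an equivalence class of doubly-even self-dual codes. -/
noncomputable def classEnumerator (m : ℕ) (q : Quotient (codeSetoid N₁ N₂)) : ConjPoly (Idx m) :=
  q.lift (fun C => ccwe (extendCode m C.1)) fun _ _ h => ccwe_eq_of_equivalent h

theorem linearIndependent_classEnumerator (hm : N₁ + N₂ ≤ 2 * (m + 1)) :
    LinearIndependent ℂ (classEnumerator (N₁ := N₁) (N₂ := N₂) m) := by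
  classical
  rw [linearIndependent_iff']
  intro s a ha q hq
  obtain ⟨C, rfl⟩ := Quotient.exists_rep q
  obtain ⟨M₀, hM₀⟩ := exists_wordCode_eq C.2.1 C.2.2 hm
  -- At the monomial of `M₀` the enumerator of `C` has a nonzero coefficient, a positive count of
  -- words, and the enumerators of all other classes have coefficient zero.
  have h := congrArg (MvPolynomial.coeff (exponent M₀)) ha
  rw [MvPolynomial.coeff_sum, Finset.sum_eq_single_of_mem _ hq] at h
  · rw [MvPolynomial.coeff_smul, MvPolynomial.coeff_zero] at h
    refine (mul_eq_zero.1 h).resolve_right ?_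
    change MvPolynomial.coeff _ (ccwe (extendCode m C.1)) ≠ 0
    rw [coeff_ccwe, Nat.cast_ne_zero, Finset.card_ne_zero]
    refine ⟨M₀, Finset.mem_filter.2 ⟨Finset.mem_univ _, ?_, rfl⟩⟩
    rw [← wordCode_le_iff (one_mem_of_selfDual C.2.1 C.2.2), hM₀]
  · intro q' _ hne
    obtain ⟨D, rfl⟩ := Quotient.exists_rep q'
    rw [MvPolynomial.coeff_smul]
    change a _ • MvPolynomial.coeff _ (ccwe (extendCode m D.1)) = 0
    rw [coeff_ccwe, Finset.card_eq_zero.2, Nat.cast_zero, smul_zero]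
    rw [Finset.filter_eq_empty_iff]
    rintro M - ⟨hM, hexp⟩
    exact hne (Quotient.sound (equivalent_of_exponent_eq C.2.2 D.2.1 D.2.2 hM₀ hM hexp.symm)).symm

theorem range_classEnumerator (m : ℕ) :
    Set.range (classEnumerator (N₁ := N₁) (N₂ := N₂) m) =
      Set.range fun C : DoublyEvenSelfDualCode N₁ N₂ => ccwe (extendCode m C.1) :=
  Set.Subset.antisymm
    (Set.range_subset_iff.2 fun q => Quotient.inductionOn q fun C => ⟨C, rfl⟩)
    (Set.range_subset_iff.2 fun C => ⟨Quotient.mk (codeSetoid N₁ N₂) C, rfl⟩)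

end

end CliffordCodes

theorem mainTheorem1 (m : ℕ) [NeZero m] (N₁ N₂ : ℕ) :
    Submodule.span ℂ (Set.range fun C : CliffordCodes.DoublyEvenSelfDualCode N₁ N₂ =>
        CliffordCodes.ccwe (CliffordCodes.extendCode m C.1)) =
      CliffordCodes.cliffordInvariants m N₁ N₂ ∧
    (((N₁ : ℝ) + (N₂ : ℝ)) / 2 ≤ (m : ℝ) + 1 →
      ∃ b : Module.Basis (Quotient (CliffordCodes.codeSetoid N₁ N₂)) ℂ
          (CliffordCodes.cliffordInvariants m N₁ N₂),
        ∀ C : CliffordCodes.DoublyEvenSelfDualCode N₁ N₂,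
          (b (Quotient.mk (CliffordCodes.codeSetoid N₁ N₂) C) :
              CliffordCodes.ConjPoly (CliffordCodes.Idx m)) =
            CliffordCodes.ccwe (CliffordCodes.extendCode m C.1)) := by
  have hspan := CliffordCodes.span_ccwe_eq_cliffordInvariants m N₁ N₂
  refine ⟨hspan, fun hm => ?_⟩
  have hm' : N₁ + N₂ ≤ 2 * (m + 1) := by
    have h : (N₁ : ℝ) + N₂ ≤ 2 * (m + 1) := by linarith
    exact_mod_cast h
  have hli := CliffordCodes.linearIndependent_classEnumerator hm'
  rw [← CliffordCodes.range_classEnumerator] at hspan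
  refine ⟨(Module.Basis.span hli).map (LinearEquiv.ofEq _ _ hspan), fun C => ?_⟩
  rw [Module.Basis.map_apply, LinearEquiv.coe_ofEq_apply, Module.Basis.span_apply]
  rfl
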